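/- Let $a\in C[0,\infty)$ with $a(0)=0$ and $a(u)>0$ for $u>0$, put $I(u)=\int_u^\infty \frac{dv}{v\,a(v)}$, and assume that $I(u)<\infty$ for all $u>0$ and $$\limsup_{u\to\infty}a(u)I(u)<\infty,\qquad \limsup_{u\to0}a(u)I(u)<\infty,$$ and that there are $c,\mu>0$ with $a(u)I^\mu(u)\ge c\,a(v)I^\mu(v)$ for all $0<u<v$. Let $$0<\Lambda<\frac1{\left(\sup_{u>0}a(u)I(u)\right)_+},\qquad H(s)=[\Lambda I(s)]^{-1/\Lambda},\quad F(s)=H'(s)a(s)=\frac1s H(s)^{\Lambda+1}\quad (s>0),\qquad H(0)=F(0)=0 .$$ Let $N\ge1$, let $\Omega\subset\mathbb R^N$ be a domain, let $T>0$ and $\Omega_T=\Omega\times(0,T)$. Let $u$ be a positive (i.e. nonnegative) bounded weak solution of $u_t\le a(u)\Delta u$ in $\Omega_T$. By this we mean that $u\in L^\infty(\Omega_T)$, $u\ge0$, that the weak spatial gradient satisfies $\nabla u\in L^2_{loc}(\Omega_T)$, that $[0,T]\ni t\mapsto u(t)\in L^0_{loc}(\Omega)$ is continuous (for convergence in measure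 on compact subsets of $\Omega$), and that for every Lipschitz function $\phi\ge0$ with compact support in $\Omega_T$ $$\int_{\Omega_T}\nabla u\cdot\nabla\big(F(u)\phi\big)\,dx\,dt\le\int_{\Omega_T}\phi_t\,H(u)\,dx\,dt ,$$ where $\nabla(F(u)\phi)=\phi F'(u)\nabla u+F(u)\nabla\phi$ (the term with $F'(u)$ being $0$ where $u=0$) and the integrand on the left is integrable. Then $u$ has finite propagation speed: for every open ball $B\subset\Omega$ and every $\epsilon\in(0,1)$ there is $s\in(0,T]$ (which may depend on $B$, $\epsilon$ and $u$) such that, if $u(x,0)=0$ for a.e. $x\in B$, then for every $t\in[0,s]$ one has $u(x,t)=0$ for a.e. $x\in\epsilon B$, where $\epsilon B$ is the ball with the same centre as $B$ and radius multiplied by $\epsilon$. -/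

import Mathlib

open MeasureTheory Set Filter Topology
open scoped ContDiff

noncomputable section

namespace FPS

/-- Euclidean space `ℝ^N`. -/
abbrev E (N : ℕ) := EuclideanSpace ℝ (Fin N)

/-- The space-time cylinder `Ω_T = Ω × (0,T)`. -/
def cyl {N : ℕ} (Ω : Set (E N)) (T : ℝ) : Set (E N × ℝ) := Ω ×ˢ Ioo 0 T

/-- `I(u) = ∫_u^∞ dv / (v a(v))`. -/
def I (a : ℝ → ℝ) (u : ℝ) : ℝ := ∫ v in Ioi u, 1 / (v * a v)

/-- The standing hypothesis on the diffusion coefficient `a ∈ C[0,∞)`. -/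
structure DiffusionCoeff (a : ℝ → ℝ) : Prop where
  cont : ContinuousOn a (Ici 0)
  zero : a 0 = 0
  pos : ∀ u, 0 < u → 0 < a u
  /-- `I(u) < ∞` for `u > 0` (the integrand is nonnegative). -/
  finite_I : ∀ u, 0 < u → IntegrableOn (fun v => 1 / (v * a v)) (Ioi u)
  /-- `limsup_{u → ∞} a(u) I(u) < ∞`. -/
  limsup_atTop : limsup (fun u => ((a u * I a u : ℝ) : EReal)) atTop < ⊤

/-- `H(s) = (Λ I(s))^(-1/Λ)` for `s > 0`, and `H(0) = 0`. -/
def H (a : ℝ → ℝ) (Λ s : ℝ) : ℝ := if 0 < s then (Λ * I a s) ^ (-1 / Λ) else 0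

/-- `F(s) = H(s)^(Λ+1) / s` for `s > 0`, and `F(0) = 0`; see `hasDerivAt_H` for `F = H' a`. -/
def F (a : ℝ → ℝ) (Λ s : ℝ) : ℝ := if 0 < s then (H a Λ s) ^ (Λ + 1) / s else 0

/-- The spatial gradient of a function on space-time. -/
def gradx {N : ℕ} (φ : E N × ℝ → ℝ) (z : E N × ℝ) : E N := gradient (fun y => φ (y, z.2)) z.1

/-- The time derivative of a function on space-time. -/
def dt {N : ℕ} (φ : E N × ℝ → ℝ) (z : E N × ℝ) : ℝ := deriv (fun τ => φ (z.1, τ)) z.2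

/-- `φ ∈ Lip_c(Q)`: Lipschitz with compact support contained in `Q`. -/
structure LipC {N : ℕ} (Q : Set (E N × ℝ)) (φ : E N × ℝ → ℝ) : Prop where
  lip : ∃ K, LipschitzWith K φ
  compact : HasCompactSupport φ
  supp : tsupport φ ⊆ Q

/-- `g` is the distributional spatial gradient of `u` in `Q`, and `g ∈ L²_loc(Q)`. -/
structure IsWeakGradx {N : ℕ} (Q : Set (E N × ℝ)) (u : E N × ℝ → ℝ) (g : E N × ℝ → E N) :
    Prop where
  memLp : ∀ K ⊆ Q, IsCompact K → MemLp g 2 (volume.restrict K)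
  weak : ∀ ψ : E N × ℝ → ℝ, ContDiff ℝ ∞ ψ → HasCompactSupport ψ → tsupport ψ ⊆ Q →
    ∫ z in Q, u z • gradx ψ z = - ∫ z in Q, ψ z • g z

/-- `∇u · ∇(F(u) φ)`, where `g = ∇u` and `∇(F(u) φ) = φ F'(u) ∇u + F(u) ∇φ`.
On `{u = 0}`, where `∇u = 0` a.e., the term with `F'` contributes `0`: `F` vanishes on `(-∞,0]`,
so `deriv F 0 = 0`. -/
def fluxTerm {N : ℕ} (a : ℝ → ℝ) (Λ : ℝ) (u : E N × ℝ → ℝ) (g : E N × ℝ → E N)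
    (φ : E N × ℝ → ℝ) (z : E N × ℝ) : ℝ :=
  inner ℝ (g z) ((φ z * deriv (F a Λ) (u z)) • g z + F a Λ (u z) • gradx φ z)

/-- A positive (i.e. nonnegative) bounded weak solution `u` of `u_t ≤ a(u) Δu` in `Ω × (0,T)`,
in the time-changed form `[H(u)]_t - F(u) Δu ≤ 0`. For `t ∈ [0,T]`, `u(t)` is the slice
`x ↦ u (x, t)`, regarded as an element of `L⁰_loc(Ω)`. The inequality includes that its left-hand
side is finite. -/
structure IsWeakSol {N : ℕ} (Ω : Set (E N)) (T : ℝ) (a : ℝ → ℝ) (Λ : ℝ) (u : E N × ℝ → ℝ) :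
    Prop where
  nonneg : ∀ᵐ z ∂(volume.restrict (cyl Ω T)), 0 ≤ u z
  bounded : MemLp u ⊤ (volume.restrict (cyl Ω T))
  meas_slice : ∀ t ∈ Icc 0 T, AEStronglyMeasurable (fun x => u (x, t)) (volume.restrict Ω)
  /-- `[0,T] ∋ t ↦ u(t) ∈ L⁰_loc(Ω)` is continuous (convergence in measure on compacts). -/
  cont : ∀ t₀ ∈ Icc 0 T, ∀ K ⊆ Ω, IsCompact K →
    TendstoInMeasure (volume.restrict K) (fun t x => u (x, t)) (𝓝[Icc 0 T] t₀)
      (fun x => u (x, t₀))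
  /-- `∇u ∈ L²_loc(Ω_T)` and the weak inequality. -/
  weak : ∃ g : E N × ℝ → E N, IsWeakGradx (cyl Ω T) u g ∧
    ∀ φ : E N × ℝ → ℝ, LipC (cyl Ω T) φ → (∀ z, 0 ≤ φ z) →
      IntegrableOn (fluxTerm a Λ u g φ) (cyl Ω T) ∧
      ∫ z in cyl Ω T, fluxTerm a Λ u g φ z ≤ ∫ z in cyl Ω T, dt φ z * H a Λ (u z)

/-- Finite propagation speed: for every open ball `B = B(x₀,r) ⊆ Ω` and `ε ∈ (0,1)` there is
`s ∈ (0,T]` such that `u(·,0) = 0` on `B` implies `u(·,t) = 0` on `εB = B(x₀,εr)` for all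
`t ∈ [0,s]`; equalities are in `L⁰`, i.e. up to null sets of `x`. -/
def FinitePropagationSpeed {N : ℕ} (Ω : Set (E N)) (T : ℝ) (u : E N × ℝ → ℝ) : Prop :=
  ∀ (x₀ : E N) (r : ℝ), 0 < r → Metric.ball x₀ r ⊆ Ω → ∀ ε ∈ Ioo (0 : ℝ) 1,
    ∃ s ∈ Ioc 0 T,
      (∀ᵐ x ∂(volume.restrict (Metric.ball x₀ r)), u (x, 0) = 0) →
      ∀ t ∈ Icc 0 s, ∀ᵐ x ∂(volume.restrict (Metric.ball x₀ (ε * r))), u (x, t) = 0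

/-- `H' = h` with `h = F / a`, i.e. `F = h a` on `(0,∞)`. -/
theorem hasDerivAt_H {a : ℝ → ℝ} (ha : DiffusionCoeff a) {Λ : ℝ} (hΛ : 0 < Λ) {s : ℝ}
    (hs : 0 < s) : HasDerivAt (H a Λ) (F a Λ s / a s) s := by
  have hf : ∀ v, 0 < v → 0 < 1 / (v * a v) := fun v hv =>
    one_div_pos.2 (mul_pos hv (ha.pos v hv))
  have hIpos : 0 < I a s := by
    refine (setIntegral_pos_iff_support_of_nonneg_ae ?_ (ha.finite_I s hs)).2 ?_
    · filter_upwards [ae_restrict_mem measurableSet_Ioi] with v hv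
      exact (hf v (hs.trans hv)).le
    · have : Function.support (fun v => 1 / (v * a v)) ∩ Ioi s = Ioi s :=
        inter_eq_right.2 fun v hv => (hf v (hs.trans hv)).ne'
      rw [this]; simp
  have hcont : ContinuousAt (fun v => 1 / (v * a v)) s := by
    have h1 : ContinuousAt a s := ha.cont.continuousAt (Ici_mem_nhds hs)
    exact continuousAt_const.div (continuousAt_id.mul h1) (mul_pos hs (ha.pos s hs)).ne'
  have hI : HasDerivAt (I a) (-(1 / (s * a s))) s := by
    have h2 : 0 < s / 2 := by positivity
    have hint : IntervalIntegrable (fun v => 1 / (v * a v)) volume (s / 2) s :=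
      (intervalIntegrable_iff_integrableOn_Ioc_of_le (by linarith)).2
        ((ha.finite_I _ h2).mono_set Ioc_subset_Ioi_self)
    have hmeas : StronglyMeasurableAtFilter (fun v => 1 / (v * a v)) (𝓝 s) volume :=
      ⟨Ioi (s / 2), Ioi_mem_nhds (by linarith), (ha.finite_I _ h2).aestronglyMeasurable⟩
    have hd := (intervalIntegral.integral_hasDerivAt_right hint hmeas hcont).const_sub (I a (s / 2))
    refine hd.congr_of_eventuallyEq ?_
    filter_upwards [Ioi_mem_nhds (show s / 2 < s by linarith)] with v hv
    have hv' : s / 2 < v := hv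
    have hsplit := intervalIntegral.integral_interval_add_Ioi (a := s / 2) (b := v)
      (f := fun v => 1 / (v * a v)) (μ := volume) (ha.finite_I _ h2)
      (ha.finite_I v (h2.trans hv'))
    simp only [I]
    linarith
  have hbase : 0 < Λ * I a s := mul_pos hΛ hIpos
  have hH := (hI.const_mul Λ).rpow_const (p := -1 / Λ) (Or.inl hbase.ne')
  have heq : H a Λ =ᶠ[𝓝 s] fun v => (Λ * I a v) ^ (-1 / Λ) := by
    filter_upwards [Ioi_mem_nhds hs] with v hv
    have hv' : 0 < v := hv
    simp [H, hv']
  refine (hH.congr_of_eventuallyEq heq).congr_deriv ?_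
  have e : (-1 / Λ) * (Λ + 1) = -1 / Λ - 1 := by field_simp; ring
  have ha' := (ha.pos s hs).ne'
  simp only [F, H, hs, if_true]
  rw [← Real.rpow_mul hbase.le, e]
  field_simp

end FPS

end

/-! In terms of `H(u)` the equation carries a superlinear gain. Testing with a squared cutoff in
space, of slope about `1/d`, bounds both the supremum over `t` of `∫ H(u)` and the dissipation `∬
F'(u)|∇u|²` on a smaller ball by `d⁻² ∬ H(u)^(Λ+1)` on a larger one, provided that the initial value
vanishes there. The cross term is absorbed because `F² ≤ Λ⁻¹ F' H^(Λ+1)` (`F_sq_le`), which comes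
from `Λ a I ≤ 1`. This is `energy_inequality`.

The dissipation must then be turned into integrability. By the almost monotonicity of `a I^μ`, some
power `H^q` is `C¹` with derivative `k` satisfying `k² ≤ C F' H` (`exists_power_profile`). Hence
`|∇H(u)^q|` is at most half the sum of the dissipation density and a multiple of `H(u)`, and its
`L¹` norm is controlled by the energy bound `B`. As `u` has only a weak gradient, this is expressed
through translations (`lintegral_comp_translate_sub_le`). Comparing `H(u)^q` with its averages over
balls of radius `ρ` gives a Nash-type bound for `∬ H(u)^(q+1)` (`mul_lintegral_le_of_translates`).
Interpolating with `∬ H(u)` and optimizing `ρ` yields `∬ H(u)^(Λ+1) ≤ C d^(-N) B^(1+δ)` on the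
smaller ball (`exists_decay`).

Here `B` may be any number in `(0,1]` exceeding a multiple of `d⁻²` times the same integral on the
larger ball. A De Giorgi iteration over radii decreasing to `ε r` therefore forces the integral to
vanish as soon as its first value is below a threshold (`exists_iteration_threshold`). Since `u` is
bounded, a short time interval achieves this. Continuity in measure extends the vanishing from
almost every time to every time (`IsWeakSol.slice_eq_zero`). -/

noncomputable section

namespace FPS

/-! ### Monotonicity, continuity and differential inequalities for `H` and `F`. -/

section Profile

variable {a : ℝ → ℝ} {Λ s : ℝ}

theorem I_pos (ha : DiffusionCoeff a) (hs : 0 < s) : 0 < I a s := by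
  have hf : ∀ v, 0 < v → 0 < 1 / (v * a v) := fun v hv =>
    one_div_pos.2 (mul_pos hv (ha.pos v hv))
  refine (setIntegral_pos_iff_support_of_nonneg_ae ?_ (ha.finite_I s hs)).2 ?_
  · filter_upwards [ae_restrict_mem measurableSet_Ioi] with v hv
    exact (hf v (hs.trans hv)).le
  · have : Function.support (fun v => 1 / (v * a v)) ∩ Ioi s = Ioi s :=
      inter_eq_right.2 fun v hv => (hf v (hs.trans hv)).ne'
    rw [this]; simp

theorem H_of_nonpos (hs : s ≤ 0) : H a Λ s = 0 := by simp [H, hs.not_gt]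

theorem H_of_pos (hs : 0 < s) : H a Λ s = (Λ * I a s) ^ (-1 / Λ) := by simp [H, hs]

theorem H_pos (ha : DiffusionCoeff a) (hΛ : 0 < Λ) (hs : 0 < s) : 0 < H a Λ s := by
  rw [H_of_pos hs]
  exact Real.rpow_pos_of_pos (mul_pos hΛ (I_pos ha hs)) _

theorem H_nonneg (ha : DiffusionCoeff a) (hΛ : 0 < Λ) (s : ℝ) : 0 ≤ H a Λ s := by
  rcases le_or_gt s 0 with h | h
  · rw [H_of_nonpos h]
  · exact (H_pos ha hΛ h).le

theorem H_rpow (ha : DiffusionCoeff a) (hΛ : 0 < Λ) (hs : 0 < s) :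
    H a Λ s ^ Λ = (Λ * I a s)⁻¹ := by
  rw [H_of_pos hs, ← Real.rpow_mul (mul_pos hΛ (I_pos ha hs)).le, div_mul_cancel₀ _ hΛ.ne',
    Real.rpow_neg_one]

theorem F_of_pos (hs : 0 < s) : F a Λ s = H a Λ s ^ (Λ + 1) / s := by simp [F, hs]

theorem F_of_nonpos (hs : s ≤ 0) : F a Λ s = 0 := by simp [F, hs.not_gt]

theorem F_nonneg (ha : DiffusionCoeff a) (hΛ : 0 < Λ) (s : ℝ) : 0 ≤ F a Λ s := by
  rcases le_or_gt s 0 with h | h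
  · rw [F_of_nonpos h]
  · rw [F_of_pos h]
    have := H_nonneg ha hΛ s
    positivity

/-- Logarithmic form of the derivative: `s H'/H = 1/(Λ a I)`, so that bounds on `a I` become growth
rates of `H`. -/
theorem hasDerivAt_H_log (ha : DiffusionCoeff a) (hΛ : 0 < Λ) (hs : 0 < s) :
    HasDerivAt (H a Λ) (H a Λ s / (s * (Λ * (a s * I a s)))) s := by
  refine (hasDerivAt_H ha hΛ hs).congr_deriv ?_
  have := I_pos ha hs
  have := ha.pos s hs
  rw [F_of_pos hs, Real.rpow_add (H_pos ha hΛ hs), H_rpow ha hΛ hs, Real.rpow_one]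
  field_simp

theorem H_monotone (ha : DiffusionCoeff a) (hΛ : 0 < Λ) : Monotone (H a Λ) := by
  have h1 : MonotoneOn (H a Λ) (Ioi 0) := by
    refine monotoneOn_of_deriv_nonneg (convex_Ioi 0)
      (fun s hs => (hasDerivAt_H_log ha hΛ hs).continuousAt.continuousWithinAt) ?_ ?_
    · rw [interior_Ioi]
      exact fun s hs => (hasDerivAt_H_log ha hΛ hs).differentiableAt.differentiableWithinAt
    · rw [interior_Ioi]
      intro s hs
      have hs' : 0 < s := hs
      rw [(hasDerivAt_H_log ha hΛ hs).deriv]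
      have := I_pos ha hs
      have := ha.pos s hs
      have := H_pos ha hΛ hs
      positivity
  intro s t hst
  rcases le_or_gt s 0 with h | h
  · rw [H_of_nonpos h]; exact H_nonneg ha hΛ t
  · exact h1 h (h.trans_le hst) hst

/-- The bound `Λ a I ≤ 1` makes the logarithmic derivative of `H` at least `1/s`, that of the
identity. -/
theorem H_div_monotoneOn (ha : DiffusionCoeff a) (hΛ : 0 < Λ)
    (hle : ∀ s, 0 < s → Λ * (a s * I a s) ≤ 1) :
    MonotoneOn (fun s => H a Λ s / s) (Ioi 0) := by
  have hd : ∀ s, 0 < s → HasDerivAt (fun s => H a Λ s / s)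
      ((H a Λ s / (s * (Λ * (a s * I a s))) * s - H a Λ s * 1) / s ^ 2) s := fun s hs =>
    (hasDerivAt_H_log ha hΛ hs).div (hasDerivAt_id s) hs.ne'
  refine monotoneOn_of_deriv_nonneg (convex_Ioi 0)
    (fun s hs => (hd s hs).continuousAt.continuousWithinAt) ?_ ?_
  · rw [interior_Ioi]
    exact fun s hs => (hd s hs).differentiableAt.differentiableWithinAt
  · rw [interior_Ioi]
    intro s hs
    have hs' : 0 < s := hs
    rw [(hd s hs).deriv]
    have hX : 0 < Λ * (a s * I a s) := mul_pos hΛ (mul_pos (ha.pos s hs) (I_pos ha hs))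
    have hH := H_pos ha hΛ hs
    have : H a Λ s * 1 ≤ H a Λ s / (s * (Λ * (a s * I a s))) * s := by
      rw [div_mul_eq_mul_div, mul_comm s (Λ * _), mul_div_mul_right _ _ hs'.ne', le_div_iff₀ hX]
      nlinarith [hle s hs]
    exact div_nonneg (by linarith) (sq_nonneg s)

theorem H_le_mul (ha : DiffusionCoeff a) (hΛ : 0 < Λ)
    (hle : ∀ s, 0 < s → Λ * (a s * I a s) ≤ 1) {M : ℝ} (hs : 0 < s) (hsM : s ≤ M) :
    H a Λ s ≤ H a Λ M / M * s := by
  have := H_div_monotoneOn ha hΛ hle hs (hs.trans_le hsM : 0 < M) hsM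
  rwa [div_le_iff₀ hs] at this

theorem H_continuous (ha : DiffusionCoeff a) (hΛ : 0 < Λ)
    (hle : ∀ s, 0 < s → Λ * (a s * I a s) ≤ 1) : Continuous (H a Λ) := by
  refine continuous_iff_continuousAt.2 fun s => ?_
  rcases lt_trichotomy s 0 with h | rfl | h
  · have : H a Λ =ᶠ[𝓝 s] fun _ => 0 := by
      filter_upwards [Iio_mem_nhds h] with v hv using H_of_nonpos (le_of_lt hv)
    exact this.continuousAt
  · rw [ContinuousAt, H_of_nonpos le_rfl]
    have hlim : Tendsto (fun s : ℝ => H a Λ 1 / 1 * |s|) (𝓝 0) (𝓝 0) := by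
      have : Continuous fun s : ℝ => H a Λ 1 / 1 * |s| := by fun_prop
      simpa using this.tendsto 0
    refine squeeze_zero' (Eventually.of_forall (H_nonneg ha hΛ)) ?_ hlim
    filter_upwards [Iio_mem_nhds (show (0 : ℝ) < 1 by norm_num)] with v hv
    rcases le_or_gt v 0 with h | h
    · rw [H_of_nonpos h]
      have := H_nonneg ha hΛ 1
      positivity
    · rw [abs_of_pos h]
      exact H_le_mul ha hΛ hle h (le_of_lt hv)
  · exact (hasDerivAt_H_log ha hΛ h).continuousAt

/-- On `(0,∞)` one has `F = H^Λ · (H/s)`, a product of nonnegative nondecreasing factors. -/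
theorem F_monotone (ha : DiffusionCoeff a) (hΛ : 0 < Λ)
    (hle : ∀ s, 0 < s → Λ * (a s * I a s) ≤ 1) : Monotone (F a Λ) := by
  intro s t hst
  rcases le_or_gt s 0 with h | h
  · rw [F_of_nonpos h]; exact F_nonneg ha hΛ t
  · have ht := h.trans_le hst
    have e : ∀ r, 0 < r → F a Λ r = H a Λ r ^ Λ * (H a Λ r / r) := fun r hr => by
      rw [F_of_pos hr, Real.rpow_add (H_pos ha hΛ hr), Real.rpow_one, mul_div_assoc]
    rw [e s h, e t ht]
    refine mul_le_mul (Real.rpow_le_rpow (H_nonneg ha hΛ s) (H_monotone ha hΛ hst) hΛ.le)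
      (H_div_monotoneOn ha hΛ hle h ht hst) ?_ ?_
    · exact div_nonneg (H_nonneg ha hΛ s) h.le
    · exact Real.rpow_nonneg (H_nonneg ha hΛ t) _

theorem hasDerivAt_F (ha : DiffusionCoeff a) (hΛ : 0 < Λ) (hs : 0 < s) :
    HasDerivAt (F a Λ) (F a Λ s / s * ((Λ + 1) / (Λ * (a s * I a s)) - 1)) s := by
  have hH := H_pos ha hΛ hs
  have h1 := ((hasDerivAt_H_log ha hΛ hs).rpow_const (p := Λ + 1) (Or.inl hH.ne')).div
    (hasDerivAt_id s) hs.ne'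
  have h2 : F a Λ =ᶠ[𝓝 s] fun v => H a Λ v ^ (Λ + 1) / v := by
    filter_upwards [Ioi_mem_nhds hs] with v hv using F_of_pos hv
  refine (h1.congr_of_eventuallyEq h2).congr_deriv ?_
  have := I_pos ha hs
  have := ha.pos s hs
  rw [F_of_pos hs, add_sub_cancel_right, Real.rpow_add hH, Real.rpow_one]
  simp only [id]
  field_simp

/-- No differentiability at `0` is needed: if `F` is differentiable there, the derivative is read
off from the left, and otherwise `deriv` takes its default value `0`. -/
theorem deriv_F_of_nonpos (hs : s ≤ 0) : deriv (F a Λ) s = 0 := by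
  by_cases hd : DifferentiableAt ℝ (F a Λ) s
  · have h1 : HasDerivWithinAt (F a Λ) (deriv (F a Λ) s) (Iic s) s :=
      hd.hasDerivAt.hasDerivWithinAt
    have h2 : HasDerivWithinAt (F a Λ) 0 (Iic s) s :=
      (hasDerivWithinAt_const s (Iic s) (0 : ℝ)).congr
        (fun v hv => F_of_nonpos (le_trans hv hs)) (F_of_nonpos hs)
    exact (uniqueDiffWithinAt_Iic s).eq_deriv _ h1 h2
  · exact deriv_zero_of_not_differentiableAt hd

/-- With `X = a I`, the factor `(Λ+1)/(ΛX) - 1` equals `1/X + (1/(ΛX) - 1)`, and the bracket is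
nonnegative. -/
theorem deriv_F_ge (ha : DiffusionCoeff a) (hΛ : 0 < Λ)
    (hle : ∀ s, 0 < s → Λ * (a s * I a s) ≤ 1) (hs : 0 < s) :
    F a Λ s / s / (a s * I a s) ≤ deriv (F a Λ) s := by
  rw [(hasDerivAt_F ha hΛ hs).deriv, div_eq_mul_one_div _ (a s * I a s)]
  have hX : 0 < a s * I a s := mul_pos (ha.pos s hs) (I_pos ha hs)
  refine mul_le_mul_of_nonneg_left ?_ (div_nonneg (F_nonneg ha hΛ s) hs.le)
  have h1 : 1 ≤ 1 / (Λ * (a s * I a s)) := by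
    rw [le_div_iff₀ (mul_pos hΛ hX)]; linarith [hle s hs]
  have h2 : (Λ + 1) / (Λ * (a s * I a s)) = 1 / (a s * I a s) + 1 / (Λ * (a s * I a s)) := by
    field_simp
  linarith

theorem deriv_F_nonneg (ha : DiffusionCoeff a) (hΛ : 0 < Λ)
    (hle : ∀ s, 0 < s → Λ * (a s * I a s) ≤ 1) (s : ℝ) : 0 ≤ deriv (F a Λ) s :=
  (F_monotone ha hΛ hle).deriv_nonneg

/-- Combine `s F = H^(Λ+1)` with `Λ F/s ≤ F'`. This lets the dissipation absorb the term `F ∇u·∇φ`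
of the flux. -/
theorem F_sq_le (ha : DiffusionCoeff a) (hΛ : 0 < Λ)
    (hle : ∀ s, 0 < s → Λ * (a s * I a s) ≤ 1) (s : ℝ) :
    F a Λ s ^ 2 ≤ 1 / Λ * deriv (F a Λ) s * H a Λ s ^ (Λ + 1) := by
  rcases le_or_gt s 0 with h | h
  · simp [F_of_nonpos h, deriv_F_of_nonpos h]
  · have hX : 0 < a s * I a s := mul_pos (ha.pos s h) (I_pos ha h)
    have h1 : Λ * (F a Λ s / s) ≤ deriv (F a Λ) s := by
      refine le_trans ?_ (deriv_F_ge ha hΛ hle h)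
      rw [le_div_iff₀ hX]
      have := div_nonneg (F_nonneg ha hΛ s) h.le
      nlinarith [hle s h]
    have h2 : H a Λ s ^ (Λ + 1) = s * F a Λ s := by
      rw [F_of_pos h]; field_simp
    have hF := F_nonneg ha hΛ s
    rw [h2]
    calc F a Λ s ^ 2 = 1 / Λ * (Λ * (F a Λ s / s)) * (s * F a Λ s) := by field_simp
      _ ≤ _ := by gcongr

/-- The lower bound for `a I` in terms of `H`. -/
theorem exists_lower_bound_aI (ha : DiffusionCoeff a) (hΛ : 0 < Λ) {c μ : ℝ} (hc : 0 < c)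
    (hmono : ∀ u v : ℝ, 0 < u → u < v → c * (a v * I a v ^ μ) ≤ a u * I a u ^ μ)
    {M : ℝ} (hM : 0 < M) :
    ∃ c₁ > 0, ∀ s, 0 < s → s ≤ M → c₁ * H a Λ s ^ (Λ * (μ - 1)) ≤ a s * I a s := by
  have hM1 : 0 < M + 1 := by linarith
  -- The comparison point is `M + 1` because the monotonicity hypothesis needs `s` strictly below
  -- it, while `s = M` is allowed. The factor `Λ^(μ-1)` converts `I^(1-μ)` into a power of `H`.
  refine ⟨c * (a (M + 1) * I a (M + 1) ^ μ) * Λ ^ (μ - 1), ?_, fun s hs hsM => ?_⟩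
  · have := Real.rpow_pos_of_pos (I_pos ha hM1) μ
    have := Real.rpow_pos_of_pos hΛ (μ - 1)
    have := ha.pos _ hM1
    positivity
  · have hI := I_pos ha hs
    have h1 := hmono s (M + 1) hs (by linarith)
    have e1 : H a Λ s ^ (Λ * (μ - 1)) = (Λ ^ (μ - 1))⁻¹ * I a s ^ (1 - μ) := by
      rw [Real.rpow_mul (H_nonneg ha hΛ s), H_rpow ha hΛ hs, Real.inv_rpow (by positivity),
        Real.mul_rpow hΛ.le hI.le, mul_inv, ← Real.rpow_neg hI.le (μ - 1), neg_sub]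
    have e2 : a s * I a s = a s * I a s ^ μ * I a s ^ (1 - μ) := by
      rw [mul_assoc, ← Real.rpow_add hI]; simp
    have hΛμ := (Real.rpow_pos_of_pos hΛ (μ - 1)).ne'
    rw [e1, e2]
    calc _ = c * (a (M + 1) * I a (M + 1) ^ μ) * I a s ^ (1 - μ) := by field_simp
      _ ≤ _ := by gcongr

/-- A power `H ^ q` is `C¹`, with derivative controlled by `(F' H) ^ (1/2)` on bounded sets. -/
theorem exists_power_profile (ha : DiffusionCoeff a) (hΛ : 0 < Λ)
    (hle : ∀ s, 0 < s → Λ * (a s * I a s) ≤ 1) {c μ : ℝ} (hc : 0 < c) (hμ : 0 < μ)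
    (hmono : ∀ u v : ℝ, 0 < u → u < v → c * (a v * I a v ^ μ) ≤ a u * I a u ^ μ) :
    ∃ q : ℝ, 1 ≤ q ∧ Λ ≤ q ∧ ∃ k : ℝ → ℝ, Continuous k ∧
      (∀ s, HasDerivAt (fun s => H a Λ s ^ q) (k s) s) ∧
      ∀ M > 0, ∃ C > 0, ∀ s ≤ M, k s ^ 2 ≤ C * (deriv (F a Λ) s * H a Λ s) := by
  have hΛμ := mul_pos hΛ hμ
  -- The exponent is large enough to split `H^q = H^(1+2Λ) · H^(Λ(μ-1)) · H`. The middle factor is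
  -- compensated by `a I` and the last by `s`, so `k = O(H^(1+2Λ))` near the origin.
  set q : ℝ := 2 + Λ * (μ + 1) with hq
  have hq0 : 0 < q := by rw [hq]; nlinarith
  set k : ℝ → ℝ := fun s => if 0 < s then q * H a Λ s ^ q / (s * (Λ * (a s * I a s))) else 0
    with hk
  have kpos : ∀ s, 0 < s → k s = q * H a Λ s ^ q / (s * (Λ * (a s * I a s))) := fun s hs => by
    simp [hk, hs]
  have kneg : ∀ s, s ≤ 0 → k s = 0 := fun s hs => by simp [hk, hs.not_gt]
  have Kneg : ∀ s, s ≤ 0 → H a Λ s ^ q = 0 := fun s hs => by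
    rw [H_of_nonpos hs, Real.zero_rpow hq0.ne']
  have hH0 := H_nonneg ha hΛ
  have Hc := H_continuous ha hΛ hle
  have kder : ∀ s, 0 < s → HasDerivAt (fun s => H a Λ s ^ q) (k s) s := fun s hs => by
    refine ((hasDerivAt_H_log ha hΛ hs).rpow_const (p := q)
      (Or.inl (H_pos ha hΛ hs).ne')).congr_deriv ?_
    have hX := mul_pos (ha.pos s hs) (I_pos ha hs)
    have hH := H_pos ha hΛ hs
    rw [kpos s hs, Real.rpow_sub_one hH.ne']
    field_simp
  -- behaviour at the origin
  obtain ⟨c₁, hc₁, hlow⟩ := exists_lower_bound_aI ha hΛ hc hmono one_pos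
  have kbound : ∀ s, s < 1 → |k s| ≤ q * (H a Λ 1 / 1) / (Λ * c₁) * H a Λ s ^ (1 + 2 * Λ) := by
    intro s hs1
    rcases le_or_gt s 0 with h | h
    · rw [kneg s h, abs_zero]
      have := hH0 1
      have := Real.rpow_nonneg (hH0 s) (1 + 2 * Λ)
      positivity
    · have hX := mul_pos (ha.pos s h) (I_pos ha h)
      have hH := H_pos ha hΛ h
      have e : H a Λ s ^ q = H a Λ s ^ (1 + 2 * Λ) * H a Λ s ^ (Λ * (μ - 1)) * H a Λ s := by
        nth_rewrite 4 [← Real.rpow_one (H a Λ s)]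
        rw [← Real.rpow_add hH, ← Real.rpow_add hH, hq]
        congr 1; ring
      have hp1 := Real.rpow_pos_of_pos hH (1 + 2 * Λ)
      have hp2 := Real.rpow_pos_of_pos hH (Λ * (μ - 1))
      have hHs := H_le_mul ha hΛ hle h hs1.le
      have hl := hlow s h hs1.le
      have hk0 : 0 ≤ k s := by
        rw [kpos s h]; have := Real.rpow_pos_of_pos hH q; positivity
      rw [abs_of_nonneg hk0, kpos s h, e]
      rw [div_le_iff₀ (by positivity)]
      calc q * (H a Λ s ^ (1 + 2 * Λ) * H a Λ s ^ (Λ * (μ - 1)) * H a Λ s)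
          ≤ q * (H a Λ s ^ (1 + 2 * Λ) * ((a s * I a s) / c₁) * (H a Λ 1 / 1 * s)) := by
            have : H a Λ s ^ (Λ * (μ - 1)) ≤ (a s * I a s) / c₁ := by
              rw [le_div_iff₀ hc₁]; linarith
            gcongr
        _ = _ := by field_simp
  have lim0 : Tendsto (fun s => H a Λ s ^ (1 + 2 * Λ)) (𝓝 0) (𝓝 0) := by
    have : Continuous fun s => H a Λ s ^ (1 + 2 * Λ) :=
      Hc.rpow_const fun _ => Or.inr (by positivity)
    have h := this.tendsto 0
    rwa [H_of_nonpos le_rfl, Real.zero_rpow (by positivity)] at h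
  have kcont0 : ContinuousAt k 0 := by
    rw [ContinuousAt, kneg 0 le_rfl]
    refine squeeze_zero_norm' ?_ (by simpa using lim0.const_mul (q * (H a Λ 1 / 1) / (Λ * c₁)))
    filter_upwards [Iio_mem_nhds (show (0 : ℝ) < 1 by norm_num)] with s hs
    simpa only [div_one, Real.norm_eq_abs] using kbound s hs
  have kcont : Continuous k := by
    refine continuous_iff_continuousAt.2 fun s => ?_
    rcases lt_trichotomy s 0 with h | rfl | h
    · have : k =ᶠ[𝓝 s] fun _ => 0 := by
        filter_upwards [Iio_mem_nhds h] with v hv using kneg v (le_of_lt hv)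
      exact this.continuousAt
    · exact kcont0
    · have : k =ᶠ[𝓝 s] fun s => q * H a Λ s ^ q / (s * (Λ * (a s * I a s))) := by
        filter_upwards [Ioi_mem_nhds h] with v hv using kpos v hv
      refine ContinuousAt.congr ?_ this.symm
      have hX := mul_pos (ha.pos s h) (I_pos ha h)
      have c1 : ContinuousAt a s := ha.cont.continuousAt (Ici_mem_nhds h)
      have c2 : ContinuousAt (I a) s := by
        -- Continuity of `I` is recovered from that of `H` by inverting `H^Λ = (Λ I)⁻¹`.
        have e : I a =ᶠ[𝓝 s] fun v => (Λ * H a Λ v ^ Λ)⁻¹ := by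
          filter_upwards [Ioi_mem_nhds h] with v hv
          have := I_pos ha hv
          rw [H_rpow ha hΛ hv]; field_simp
        refine ContinuousAt.congr ?_ e.symm
        have := Real.rpow_pos_of_pos (H_pos ha hΛ h) Λ
        exact ((Hc.continuousAt.rpow_const (Or.inr hΛ.le)).const_mul Λ).inv₀ (by positivity)
      exact ((Hc.continuousAt.rpow_const (Or.inr hq0.le)).const_mul q).div
        (continuousAt_id.mul ((c1.mul c2).const_mul Λ)) (by positivity)
  refine ⟨q, by rw [hq]; nlinarith, by rw [hq]; nlinarith, k, kcont, fun s => ?_,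
    fun M hM => ?_⟩
  · rcases lt_trichotomy s 0 with h | rfl | h
    · rw [kneg s h.le]
      refine (hasDerivAt_const s (0 : ℝ)).congr_of_eventuallyEq ?_
      filter_upwards [Iio_mem_nhds h] with v hv using Kneg v (le_of_lt hv)
    -- At the origin the derivative is obtained as the limit of the derivatives at nearby points.
    · refine hasDerivAt_of_hasDerivAt_of_ne (x := (0 : ℝ)) (fun y hy => ?_) ?_ kcont0
      · rcases lt_or_gt_of_ne hy with h | h
        · rw [kneg y h.le]
          refine (hasDerivAt_const y (0 : ℝ)).congr_of_eventuallyEq ?_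
          filter_upwards [Iio_mem_nhds h] with v hv using Kneg v (le_of_lt hv)
        · exact kder y h
      · exact (Hc.rpow_const fun _ => Or.inr hq0.le).continuousAt
    · exact kder s h
  · obtain ⟨c₁, hc₁, hlow⟩ := exists_lower_bound_aI ha hΛ hc hmono hM
    have hHM := H_pos ha hΛ hM
    -- This is the exponent left over when `k²` is compared with `F' H` and the lower bound for `a
    -- I` is used. It is positive, so the surplus power of `H` is bounded by its value at `M`.
    set e : ℝ := 2 + Λ * μ + 2 * Λ with he
    refine ⟨q ^ 2 / (Λ ^ 2 * c₁) * H a Λ M ^ e, ?_, fun s hsM => ?_⟩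
    · have := Real.rpow_pos_of_pos hHM e
      positivity
    rcases le_or_gt s 0 with h | h
    · simp [kneg s h, H_of_nonpos h]
    have hX := mul_pos (ha.pos s h) (I_pos ha h)
    have hH := H_pos ha hΛ h
    have hF := deriv_F_ge ha hΛ hle h
    have hl := hlow s h hsM
    set X := a s * I a s with hXdef
    have hHe : H a Λ s ^ e ≤ H a Λ M ^ e :=
      Real.rpow_le_rpow hH.le (H_monotone ha hΛ hsM) (by positivity)
    have hsplit : (H a Λ s ^ q) ^ 2 =
        H a Λ s ^ e * H a Λ s ^ (Λ + 1) * H a Λ s * H a Λ s ^ (Λ * (μ - 1)) := by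
      nth_rewrite 4 [← Real.rpow_one (H a Λ s)]
      rw [← Real.rpow_add hH, ← Real.rpow_add hH, ← Real.rpow_add hH, ← Real.rpow_natCast,
        ← Real.rpow_mul hH.le, hq, he]
      congr 1; push_cast; ring
    have hp := Real.rpow_pos_of_pos hH (Λ + 1)
    have hp2 := Real.rpow_pos_of_pos hHM e
    have hp3 := Real.rpow_pos_of_pos hH e
    rw [kpos s h]
    calc (q * H a Λ s ^ q / (s * (Λ * X))) ^ 2
        = q ^ 2 / (s ^ 2 * Λ ^ 2 * X ^ 2) * (H a Λ s ^ e * H a Λ s ^ (Λ + 1) * H a Λ s *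
            H a Λ s ^ (Λ * (μ - 1))) := by
          rw [← hsplit]; field_simp
      _ ≤ q ^ 2 / (s ^ 2 * Λ ^ 2 * X ^ 2) * (H a Λ M ^ e * H a Λ s ^ (Λ + 1) * H a Λ s *
            (X / c₁)) := by
          have : H a Λ s ^ (Λ * (μ - 1)) ≤ X / c₁ := by rw [le_div_iff₀ hc₁]; linarith
          gcongr
      _ = q ^ 2 / (Λ ^ 2 * c₁) * H a Λ M ^ e * (F a Λ s / s / X * H a Λ s) := by
          rw [F_of_pos h]; field_simp
      _ ≤ _ := by gcongr

end Profile

/-! ### Chain rule along absolutely continuous curves. -/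

section ChainRule

/-- The composition of a `C¹` function with an absolutely continuous one. -/
theorem absolutelyContinuousOnInterval_comp {f K k : ℝ → ℝ} {a b : ℝ}
    (hf : AbsolutelyContinuousOnInterval f a b) (hk : Continuous k)
    (hK : ∀ s, HasDerivAt K (k s) s) :
    AbsolutelyContinuousOnInterval (fun x => K (f x)) a b := by
  -- The curve has bounded range, on which `K` is Lipschitz.
  obtain ⟨B, hB⟩ := hf.exists_bound
  obtain ⟨L, hL⟩ := (isCompact_Icc (a := -B) (b := B)).exists_bound_of_continuousOn
    hk.continuousOn
  have hlip : ∀ x ∈ Icc (-B) B, ∀ y ∈ Icc (-B) B, dist (K x) (K y) ≤ L * dist x y := by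
    intro x hx y hy
    rw [dist_eq_norm, dist_eq_norm]
    exact (convex_Icc (-B) B).norm_image_sub_le_of_norm_hasDerivWithin_le
      (fun z _ => (hK z).hasDerivWithinAt) hL hy hx
  have hmem : ∀ x ∈ uIcc a b, f x ∈ Icc (-B) B := fun x hx => abs_le.1 (hB x hx)
  rw [absolutelyContinuousOnInterval_iff] at hf ⊢
  intro ε hε
  obtain ⟨δ, hδ, h⟩ := hf (ε / (|L| + 1)) (by positivity)
  refine ⟨δ, hδ, fun E hE hlen => ?_⟩
  have h1 := h E hE hlen
  rw [lt_div_iff₀ (by positivity)] at h1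
  refine lt_of_le_of_lt ?_ h1
  rw [Finset.sum_mul]
  refine Finset.sum_le_sum fun i hi => ?_
  have hi' := hE.1 i hi
  refine (hlip _ (hmem _ hi'.1) _ (hmem _ hi'.2)).trans ?_
  rw [mul_comm]
  exact mul_le_mul_of_nonneg_left ((le_abs_self L).trans (by linarith)) dist_nonneg

/-- The composition is absolutely continuous, and the classical chain rule holds at almost every
point, where the primitive is differentiable with derivative `γ`. -/
theorem intervalIntegral_comp_primitive {γ K k : ℝ → ℝ} {c t : ℝ}
    (hγ : IntervalIntegrable γ volume 0 t) (hk : Continuous k)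
    (hK : ∀ s, HasDerivAt K (k s) s) :
    K (c + ∫ τ in (0 : ℝ)..t, γ τ) - K c =
      ∫ σ in (0 : ℝ)..t, k (c + ∫ τ in (0 : ℝ)..σ, γ τ) * γ σ := by
  have hK' : ∀ s, HasDerivAt (fun s => K (c + s)) (k (c + s)) s := fun s => by
    simpa using (hK (c + s)).comp_const_add c s
  have hac := absolutelyContinuousOnInterval_comp
    (hγ.absolutelyContinuousOnInterval_intervalIntegral (c := 0) (by simp))
    (hk.comp (continuous_const_add c)) hK'
  have h := hac.integral_deriv_eq_sub
  simp only [intervalIntegral.integral_same, add_zero] at h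
  rw [← h]
  refine intervalIntegral.integral_congr_ae ?_
  filter_upwards [hγ.ae_hasDerivAt_integral] with x hx hxm
  have h1 := hx (uIoc_subset_uIcc hxm) 0 (by simp)
  exact ((hK' _).comp x h1).deriv

end ChainRule

/-! ### Translates of functions with a weak directional derivative. -/

section Translation

variable {Z : Type*} [NormedAddCommGroup Z] [NormedSpace ℝ Z] [FiniteDimensional ℝ Z]
  [MeasurableSpace Z] [BorelSpace Z] {μ : Measure Z} [μ.IsAddHaarMeasure]

/-- By translation invariance all slices in the parameter have the same `L¹` norm, so Tonelli
applies on a bounded parameter interval. -/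
theorem integrable_translates {f : Z → ℝ} (hf : Measurable f) (hfi : Integrable f μ) (e : Z)
    (t : ℝ) :
    Integrable (fun p : Z × ℝ => f (p.1 + p.2 • e)) (μ.prod (volume.restrict (Ioc 0 t))) := by
  have hm : Measurable fun p : Z × ℝ => f (p.1 + p.2 • e) :=
    hf.comp (measurable_fst.add (measurable_snd.smul_const e))
  rw [integrable_prod_iff' hm.aestronglyMeasurable]
  refine ⟨Eventually.of_forall fun σ => hfi.comp_add_right (σ • e), ?_⟩
  have : ∀ σ : ℝ, ∫ x, ‖f (x + σ • e)‖ ∂μ = ∫ x, ‖f x‖ ∂μ := fun σ =>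
    integral_add_right_eq_self (fun x => ‖f x‖) (σ • e)
  simp only [this]
  exact integrable_const _

/-- A function with distributional derivative `γ` in direction `e` is a.e. recovered by
integrating `γ` along segments. -/
theorem ae_sub_eq_integral {u γ : Z → ℝ} (hu : Measurable u) {M : ℝ} (hM : ∀ z, |u z| ≤ M)
    (hγ : Measurable γ) (hγi : Integrable γ μ) {e : Z} {O A : Set Z}
    (hw : ∀ ψ : Z → ℝ, ContDiff ℝ ∞ ψ → HasCompactSupport ψ → tsupport ψ ⊆ O →
      ∫ z, u z * fderiv ℝ ψ z e ∂μ = - ∫ z, ψ z * γ z ∂μ)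
    (hA : IsOpen A) {t : ℝ} (ht : 0 ≤ t) (hAO : ∀ σ ∈ Icc 0 t, ∀ z ∈ A, z + σ • e ∈ O) :
    ∀ᵐ z ∂μ, z ∈ A → u (z + t • e) - u z = ∫ σ in (0 : ℝ)..t, γ (z + σ • e) := by
  have hub : LocallyIntegrable u μ := by
    refine (locallyIntegrable_const M).mono hu.aestronglyMeasurable (Eventually.of_forall ?_)
    intro z
    exact (hM z).trans (le_abs_self M)
  have hub' : LocallyIntegrable (fun z => u (z + t • e)) μ := by
    refine (locallyIntegrable_const M).mono
      (hu.comp (measurable_add_const _)).aestronglyMeasurable (Eventually.of_forall ?_)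
    intro z
    exact (hM _).trans (le_abs_self M)
  have hG := integrable_translates hγ hγi e t
  have hGi : Integrable (fun z => ∫ σ in (0 : ℝ)..t, γ (z + σ • e)) μ := by
    simpa only [intervalIntegral.integral_of_le ht] using hG.integral_prod_left
  have key := hA.ae_eq_zero_of_integral_contDiff_smul_eq_zero (μ := μ)
    (f := fun z => u (z + t • e) - u z - ∫ σ in (0 : ℝ)..t, γ (z + σ • e))
    (((hub'.sub hub).sub hGi.locallyIntegrable).locallyIntegrableOn A) ?_
  · filter_upwards [key] with z hz hzA
    linarith [hz hzA]
  intro ψ hψ hψc hψA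
  have hψcont := hψ.continuous
  have i1 : Integrable (fun z => ψ z * u (z + t • e)) μ :=
    hub'.integrable_smul_left_of_hasCompactSupport hψcont hψc
  have i2 : Integrable (fun z => ψ z * u z) μ :=
    hub.integrable_smul_left_of_hasCompactSupport hψcont hψc
  have i3 : Integrable (fun z => ψ z * ∫ σ in (0 : ℝ)..t, γ (z + σ • e)) μ :=
    hGi.locallyIntegrable.integrable_smul_left_of_hasCompactSupport hψcont hψc
  have e1 : ∫ z, ψ z * u (z + t • e) ∂μ = ∫ z, ψ (z - t • e) * u z ∂μ := by
    rw [← integral_add_right_eq_self (fun z => ψ (z - t • e) * u z) (t • e)]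
    simp
  have i1' : Integrable (fun z => ψ (z - t • e) * u z) μ := by
    refine hub.integrable_smul_left_of_hasCompactSupport
      (hψcont.comp (continuous_id.sub continuous_const)) ?_
    exact hψc.comp_homeomorph (Homeomorph.subRight (t • e))
  set D : Z → ℝ := fun z => fderiv ℝ ψ z e with hD
  have hDcont : Continuous D := (hψ.continuous_fderiv (by simp)).clm_apply continuous_const
  have hDc : HasCompactSupport D := hψc.fderiv_apply ℝ e
  -- the double integral
  have hdb : Integrable (fun p : Z × ℝ => u p.1 * D (p.1 - p.2 • e))
      (μ.prod (volume.restrict (Ioc 0 t))) := by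
    have h1 := integrable_translates hDcont.measurable (hDcont.integrable_of_hasCompactSupport hDc)
      (-e) t (μ := μ)
    simp only [smul_neg, ← sub_eq_add_neg] at h1
    exact h1.bdd_mul (hu.comp measurable_fst).aestronglyMeasurable
      (Eventually.of_forall fun p => hM p.1)
  have hda : Integrable (fun p : Z × ℝ => ψ p.1 * γ (p.1 + p.2 • e))
      (μ.prod (volume.restrict (Ioc 0 t))) := by
    obtain ⟨B, hB⟩ := hψc.exists_bound_of_continuous hψcont
    exact hG.bdd_mul (hψcont.comp continuous_fst).aestronglyMeasurable
      (Eventually.of_forall fun p => hB p.1)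
  -- The core identity: by Fubini and a change of variables the derivative is tested against `ψ(· -
  -- σe)`, whose support stays in `O`. Integrating the resulting `-Dψ(· - σe)` over `σ` telescopes
  -- to `ψ(· - te) - ψ`.
  have e3 : ∫ z, (ψ z * ∫ σ in (0 : ℝ)..t, γ (z + σ • e)) ∂μ
      = ∫ z, (ψ (z - t • e) - ψ z) * u z ∂μ := by
    have s1 : ∫ z, (ψ z * ∫ σ in (0 : ℝ)..t, γ (z + σ • e)) ∂μ
        = ∫ σ in Ioc 0 t, ∫ z, ψ z * γ (z + σ • e) ∂μ := by
      rw [← integral_integral_swap hda]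
      simp only [integral_const_mul, intervalIntegral.integral_of_le ht]
    have s2 : ∀ σ ∈ Ioc 0 t, ∫ z, ψ z * γ (z + σ • e) ∂μ
        = - ∫ z, u z * D (z - σ • e) ∂μ := by
      intro σ hσ
      have h1 : ∫ z, ψ z * γ (z + σ • e) ∂μ = ∫ z, ψ (z - σ • e) * γ z ∂μ := by
        rw [← integral_add_right_eq_self (fun z => ψ (z - σ • e) * γ z) (σ • e)]
        simp
      have h2 := hw (fun z => ψ (z - σ • e)) (hψ.comp (contDiff_id.sub contDiff_const))
        (hψc.comp_homeomorph (Homeomorph.subRight (σ • e))) ?_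
      · rw [h1, eq_neg_iff_add_eq_zero, ← neg_eq_iff_add_eq_zero, ← h2]
        refine integral_congr_ae (Eventually.of_forall fun z => ?_)
        simp only [hD, fderiv_comp_sub]
      · intro z hz
        have hz' : z - σ • e ∈ tsupport ψ := by
          have := tsupport_comp_eq_preimage ψ (Homeomorph.subRight (σ • e))
          have h3 : z ∈ tsupport (ψ ∘ ⇑(Homeomorph.subRight (σ • e))) := hz
          rw [this] at h3
          exact h3
        simpa using hAO σ (Ioc_subset_Icc_self hσ) _ (hψA hz')
    rw [s1, setIntegral_congr_fun measurableSet_Ioc s2, integral_neg, ← integral_integral_swap hdb,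
      ← integral_neg]
    refine integral_congr_ae (Eventually.of_forall fun z => ?_)
    simp only [integral_const_mul]
    have h3 : ∫ σ in (0 : ℝ)..t, -D (z - σ • e) = ψ (z - t • e) - ψ (z - (0 : ℝ) • e) := by
      refine intervalIntegral.integral_eq_sub_of_hasDerivAt (f := fun σ : ℝ => ψ (z - σ • e))
        (fun σ _ => ?_) ?_
      · have hd : HasFDerivAt ψ (fderiv ℝ ψ (z - σ • e)) (z - σ • e) :=
          (hψ.differentiable (by simp) _).hasFDerivAt
        have hl : HasDerivAt (fun σ : ℝ => z - σ • e) (-e) σ := by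
          simpa using ((hasDerivAt_id σ).smul_const e).const_sub z
        have h4 : HasDerivAt (fun σ : ℝ => ψ (z - σ • e)) _ σ := hd.comp_hasDerivAt σ hl
        exact h4.congr_deriv (map_neg _ _)
      · refine Continuous.intervalIntegrable ?_ _ _
        exact (hDcont.comp (by fun_prop)).neg
    rw [intervalIntegral.integral_neg, intervalIntegral.integral_of_le ht, zero_smul, sub_zero] at h3
    rw [← h3]; ring
  simp only [smul_eq_mul, mul_sub]
  have i12 : Integrable (fun z => ψ z * u (z + t • e) - ψ z * u z) μ := i1.sub i2
  rw [integral_sub i12 i3, integral_sub i1 i2, e1, e3]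
  simp only [sub_mul]
  rw [integral_sub i1' i2, sub_self]

/-- The `L¹` modulus of continuity of `K ∘ u` under translations, for `K` of class `C¹`. -/
theorem lintegral_comp_translate_sub_le {u γ : Z → ℝ} (hu : Measurable u) {M : ℝ}
    (hM : ∀ z, |u z| ≤ M) (hγ : Measurable γ) (hγi : Integrable γ μ) {e : Z} {O A : Set Z}
    (hw : ∀ ψ : Z → ℝ, ContDiff ℝ ∞ ψ → HasCompactSupport ψ → tsupport ψ ⊆ O →
      ∫ z, u z * fderiv ℝ ψ z e ∂μ = - ∫ z, ψ z * γ z ∂μ)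
    (hA : IsOpen A) (hO : MeasurableSet O)
    (hAO : ∀ σ ∈ Icc (0 : ℝ) 1, ∀ z ∈ A, z + σ • e ∈ O) {K k : ℝ → ℝ} (hk : Continuous k)
    (hK : ∀ s, HasDerivAt K (k s) s) :
    ∫⁻ z in A, ‖K (u (z + e)) - K (u z)‖ₑ ∂μ ≤ ∫⁻ z in O, ‖k (u z) * γ z‖ₑ ∂μ := by
  have hG := integrable_translates hγ hγi e 1
  have hline : ∀ᵐ z ∂μ, IntervalIntegrable (fun σ => γ (z + σ • e)) volume 0 1 := by
    filter_upwards [hG.prod_right_ae] with z hz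
    exact (intervalIntegrable_iff_integrableOn_Ioc_of_le zero_le_one).2 hz
  have h1 := ae_sub_eq_integral hu hM hγ hγi hw hA zero_le_one hAO
  have hms : MeasurableSet {p : ℝ × Z | p.1 ∈ Ioc (0 : ℝ) 1 → p.2 ∈ A →
      u (p.2 + p.1 • e) - u p.2 = ∫ τ in (0 : ℝ)..p.1, γ (p.2 + τ • e)} := by
    -- Writing the variable endpoint as an indicator turns the primitive into a parametric integral
    -- of a jointly measurable function.
    have hI : Measurable fun p : ℝ × Z =>
        ∫ τ, (Ioc 0 p.1).indicator (fun τ => γ (p.2 + τ • e)) τ := by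
      have : StronglyMeasurable fun q : (ℝ × Z) × ℝ =>
          (Ioc 0 q.1.1).indicator (fun τ => γ (q.1.2 + τ • e)) q.2 := by
        have hset : MeasurableSet {q : (ℝ × Z) × ℝ | 0 < q.2 ∧ q.2 ≤ q.1.1} :=
          (measurableSet_lt measurable_const measurable_snd).inter
            (measurableSet_le measurable_snd (measurable_fst.comp measurable_fst))
        have hmq : Measurable fun q : (ℝ × Z) × ℝ => γ (q.1.2 + q.2 • e) :=
          hγ.comp ((measurable_snd.comp measurable_fst).add (measurable_snd.smul_const e))
        exact (hmq.indicator hset).stronglyMeasurable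
      exact this.integral_prod_right.measurable
    have e : {p : ℝ × Z | p.1 ∈ Ioc (0 : ℝ) 1 → p.2 ∈ A →
        u (p.2 + p.1 • e) - u p.2 = ∫ τ in (0 : ℝ)..p.1, γ (p.2 + τ • e)} =
        {p : ℝ × Z | p.1 ∈ Ioc (0 : ℝ) 1 → p.2 ∈ A → u (p.2 + p.1 • e) - u p.2 =
          ∫ τ, (Ioc 0 p.1).indicator (fun τ => γ (p.2 + τ • e)) τ} := by
      ext p
      refine forall_congr' fun hp => ?_
      rw [intervalIntegral.integral_of_le hp.1.le, integral_indicator measurableSet_Ioc]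
    rw [e]
    refine (measurable_fst measurableSet_Ioc).imp
      ((measurable_snd hA.measurableSet).imp (measurableSet_eq_fun ?_ hI))
    exact (hu.comp (measurable_snd.add (measurable_fst.smul_const _))).sub
      (hu.comp measurable_snd)
  -- The segment formula is known for each `σ` at almost every `z`. The chain rule needs it at
  -- almost every `z` for almost every `σ`, and joint measurability permits the exchange.
  have h2 : ∀ᵐ z ∂μ, ∀ᵐ σ : ℝ, σ ∈ Ioc (0 : ℝ) 1 → z ∈ A →
      u (z + σ • e) - u z = ∫ τ in (0 : ℝ)..σ, γ (z + τ • e) := by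
    rw [← Measure.ae_ae_comm hms]
    refine Eventually.of_forall fun σ => ?_
    by_cases hσ : σ ∈ Ioc (0 : ℝ) 1
    · filter_upwards [ae_sub_eq_integral hu hM hγ hγi hw hA hσ.1.le
        (fun τ hτ => hAO τ ⟨hτ.1, hτ.2.trans hσ.2⟩)] with z hz _ using hz
    · exact Eventually.of_forall fun z h => absurd h hσ
  have hmkγ : Measurable fun z => ‖k (u z) * γ z‖ₑ := ((hk.measurable.comp hu).mul hγ).enorm
  have hpt : ∀ᵐ z ∂(μ.restrict A), ‖K (u (z + e)) - K (u z)‖ₑ ≤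
      ∫⁻ σ in Ioc (0 : ℝ) 1, ‖k (u (z + σ • e)) * γ (z + σ • e)‖ₑ := by
    rw [ae_restrict_iff' hA.measurableSet]
    filter_upwards [hline, h1, h2] with z hz hz1 hz2 hzA
    have e1 := intervalIntegral_comp_primitive (c := u z) hz hk hK
    have e0 : u (z + e) = u z + ∫ σ in (0 : ℝ)..1, γ (z + σ • e) := by
      rw [← hz1 hzA]; simp
    rw [e0, e1, intervalIntegral.integral_of_le zero_le_one]
    refine (enorm_integral_le_lintegral_enorm _).trans (le_of_eq ?_)
    refine setLIntegral_congr_fun_ae measurableSet_Ioc ?_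
    filter_upwards [hz2] with σ hσ hσm
    rw [← hσ hσm hzA]; simp
  calc ∫⁻ z in A, ‖K (u (z + e)) - K (u z)‖ₑ ∂μ
      ≤ ∫⁻ z in A, ∫⁻ σ in Ioc (0 : ℝ) 1, ‖k (u (z + σ • e)) * γ (z + σ • e)‖ₑ ∂volume ∂μ :=
        lintegral_mono_ae hpt
    _ = ∫⁻ σ in Ioc (0 : ℝ) 1, ∫⁻ z in A, ‖k (u (z + σ • e)) * γ (z + σ • e)‖ₑ ∂μ := by
        refine lintegral_lintegral_swap (Measurable.aemeasurable ?_)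
        exact hmkγ.comp (measurable_fst.add (measurable_snd.smul_const e))
    _ ≤ ∫⁻ σ in Ioc (0 : ℝ) 1, ∫⁻ z in O, ‖k (u z) * γ z‖ₑ ∂μ := by
        -- For each `σ` the translate `A + σe` lies in `O`, and translating the integral costs
        -- nothing.
        refine setLIntegral_mono' measurableSet_Ioc fun σ hσ => ?_
        rw [← lintegral_indicator hA.measurableSet, ← lintegral_indicator hO,
          ← lintegral_add_right_eq_self (O.indicator _) (σ • e)]
        refine lintegral_mono fun z => ?_
        by_cases hz : z ∈ A
        · simp [hz, hAO σ (Ioc_subset_Icc_self hσ) z hz]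
        · simp [hz]
    _ = _ := by simp

end Translation

/-! ### Cutoff functions in time and space. -/

section Cutoffs

/-- The piecewise linear function rising from `0` at `b` to `1` at `b + η`. -/
def ramp (b η t : ℝ) : ℝ := max 0 (min ((t - b) / η) 1)

/-- The trapezoidal function which is `1` on `[t₀, t₁]` and `0` off `[t₀ - η, t₁ + η]`. -/
def trapezoid (t₀ t₁ η t : ℝ) : ℝ := ramp (t₀ - η) η t - ramp t₁ η t

variable {b η t t₀ t₁ : ℝ}

theorem ramp_of_le (hη : 0 < η) (h : t ≤ b) : ramp b η t = 0 := by
  have : (t - b) / η ≤ 0 := div_nonpos_of_nonpos_of_nonneg (by linarith) hη.le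
  rw [ramp, max_eq_left]
  exact (min_le_left _ _).trans this

theorem ramp_of_ge (hη : 0 < η) (h : b + η ≤ t) : ramp b η t = 1 := by
  have : 1 ≤ (t - b) / η := by rw [le_div_iff₀ hη]; linarith
  rw [ramp, min_eq_right this]; simp

theorem ramp_of_mem (hη : 0 < η) (h₁ : b ≤ t) (h₂ : t ≤ b + η) : ramp b η t = (t - b) / η := by
  have h1 : (t - b) / η ≤ 1 := by rw [div_le_iff₀ hη]; linarith
  have h2 : 0 ≤ (t - b) / η := div_nonneg (by linarith) hη.le
  rw [ramp, min_eq_left h1, max_eq_right h2]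

theorem ramp_nonneg : 0 ≤ ramp b η t := le_max_left _ _

theorem ramp_le_one : ramp b η t ≤ 1 := max_le zero_le_one (min_le_right _ _)

theorem lipschitzWith_ramp (b : ℝ) (η : NNReal) : LipschitzWith (1 / η) (ramp b η) := by
  have h1 : LipschitzWith (1 / η) fun t : ℝ => (t - b) / η := by
    refine LipschitzWith.of_dist_le_mul fun x y => le_of_eq ?_
    rw [Real.dist_eq, Real.dist_eq, ← sub_div, sub_sub_sub_cancel_right, abs_div]
    simp [div_eq_inv_mul]
  exact (h1.min_const 1).const_max 0

theorem hasDerivAt_ramp (hη : 0 < η) (h₁ : t ≠ b) (h₂ : t ≠ b + η) :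
    HasDerivAt (ramp b η) ((Ioo b (b + η)).indicator (fun _ => 1 / η) t) t := by
  rcases lt_or_gt_of_ne h₁ with h | h
  · rw [indicator_of_notMem (fun hm => hm.1.not_gt h)]
    refine (hasDerivAt_const t (0 : ℝ)).congr_of_eventuallyEq ?_
    filter_upwards [Iio_mem_nhds h] with v hv using ramp_of_le hη (le_of_lt hv)
  rcases lt_or_gt_of_ne h₂ with h' | h'
  · rw [indicator_of_mem (show t ∈ Ioo b (b + η) from ⟨h, h'⟩)]
    refine (((hasDerivAt_id t).sub_const b).div_const η).congr_of_eventuallyEq ?_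
    filter_upwards [Ioo_mem_nhds h h'] with v hv using ramp_of_mem hη hv.1.le hv.2.le
  · rw [indicator_of_notMem (fun hm => hm.2.not_gt h')]
    refine (hasDerivAt_const t (1 : ℝ)).congr_of_eventuallyEq ?_
    filter_upwards [Ioi_mem_nhds h'] with v hv using ramp_of_ge hη (le_of_lt hv)

theorem trapezoid_eq_one (hη : 0 < η) (h₀ : t₀ ≤ t) (h₁ : t ≤ t₁) :
    trapezoid t₀ t₁ η t = 1 := by
  rw [trapezoid, ramp_of_le hη h₁, ramp_of_ge hη (by linarith), sub_zero]

theorem trapezoid_mem_Icc (hη : 0 < η) (h₀ : t₀ ≤ t₁) : trapezoid t₀ t₁ η t ∈ Icc (0 : ℝ) 1 := by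
  rw [trapezoid]
  rcases le_total t t₁ with h | h
  · rw [ramp_of_le hη h, sub_zero]
    exact ⟨ramp_nonneg, ramp_le_one⟩
  · rw [ramp_of_ge hη (show t₀ - η + η ≤ t by linarith)]
    exact ⟨sub_nonneg.2 ramp_le_one, by linarith [ramp_nonneg (b := t₁) (η := η) (t := t)]⟩

theorem trapezoid_eq_zero (hη : 0 < η) (h₀ : t₀ ≤ t₁) (h : t ∉ Icc (t₀ - η) (t₁ + η)) :
    trapezoid t₀ t₁ η t = 0 := by
  rw [mem_Icc, not_and_or, not_le, not_le] at h
  rw [trapezoid]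
  rcases h with h | h
  · rw [ramp_of_le hη h.le, ramp_of_le hη (by linarith), sub_zero]
  · rw [ramp_of_ge hη (by linarith), ramp_of_ge hη (by linarith), sub_self]

theorem lipschitzWith_trapezoid (t₀ t₁ : ℝ) (η : NNReal) :
    LipschitzWith (1 / η + 1 / η) (trapezoid t₀ t₁ η) :=
  (lipschitzWith_ramp _ η).sub (lipschitzWith_ramp _ η)

theorem deriv_trapezoid_ae (t₀ t₁ : ℝ) (hη : 0 < η) :
    ∀ᵐ t, deriv (trapezoid t₀ t₁ η) t = (Ioo (t₀ - η) t₀).indicator (fun _ => 1 / η) t -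
      (Ioo t₁ (t₁ + η)).indicator (fun _ => 1 / η) t := by
  have hne : ∀ c : ℝ, ∀ᵐ t : ℝ, t ≠ c := fun c => by simp [ae_iff, measure_singleton]
  filter_upwards [hne (t₀ - η), hne (t₀ - η + η), hne t₁, hne (t₁ + η)] with t h1 h2 h3 h4
  have := (hasDerivAt_ramp hη h1 h2).sub (hasDerivAt_ramp hη h3 h4)
  rw [sub_add_cancel] at this
  exact this.deriv

/-- Testing against the derivatives of trapezoids recovers the increments of a continuous
function. -/
theorem le_sub_of_le_integral_deriv_trapezoid {T X t₀ t₁ η₀ : ℝ} {m : ℝ → ℝ}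
    (hm : ContinuousOn m (Icc 0 T)) (h₀ : 0 < t₀) (h₀₁ : t₀ < t₁) (h₁ : t₁ < T) (hη₀ : 0 < η₀)
    (h : ∀ η, 0 < η → η < η₀ →
      X ≤ ∫ t in Ioo 0 T, deriv (trapezoid t₀ t₁ η) t * m t) :
    X ≤ m t₀ - m t₁ := by
  refine le_of_forall_pos_le_add fun ε hε => ?_
  have c0 : ContinuousAt m t₀ := hm.continuousAt (Icc_mem_nhds h₀ (h₀₁.trans h₁))
  have c1 : ContinuousAt m t₁ := hm.continuousAt (Icc_mem_nhds (h₀.trans h₀₁) h₁)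
  obtain ⟨δ₀, hδ₀, hm0⟩ := Metric.continuousAt_iff.1 c0 (ε / 2) (by positivity)
  obtain ⟨δ₁, hδ₁, hm1⟩ := Metric.continuousAt_iff.1 c1 (ε / 2) (by positivity)
  -- For small `η` the derivative of the trapezoid is the difference of averages over `(t₀ - η, t₀)`
  -- and `(t₁, t₁ + η)`. Both edges must stay inside `(0,T)` and within the continuity scales of
  -- `m`.
  obtain ⟨η, hη, hηlt⟩ := exists_between
    (show 0 < min (min η₀ t₀) (min (T - t₁) (min δ₀ δ₁)) by
      simp only [lt_min_iff]; exact ⟨⟨hη₀, h₀⟩, by linarith, hδ₀, hδ₁⟩)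
  simp only [lt_min_iff] at hηlt
  obtain ⟨⟨g1, g2⟩, g3, g4, g5⟩ := hηlt
  refine (h η hη g1).trans ?_
  have hmi : IntegrableOn m (Ioo 0 T) :=
    (hm.integrableOn_compact isCompact_Icc).mono_set Ioo_subset_Icc_self
  have hs0 : Ioo (t₀ - η) t₀ ⊆ Ioo 0 T := Ioo_subset_Ioo (by linarith) (by linarith)
  have hs1 : Ioo t₁ (t₁ + η) ⊆ Ioo 0 T := Ioo_subset_Ioo (by linarith) (by linarith)
  have e : ∫ t in Ioo 0 T, deriv (trapezoid t₀ t₁ η) t * m t =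
      (∫ t in Ioo (t₀ - η) t₀, 1 / η * m t) - ∫ t in Ioo t₁ (t₁ + η), 1 / η * m t := by
    have i0 : IntegrableOn (fun t => 1 / η * m t) (Ioo (t₀ - η) t₀) :=
      (hmi.mono_set hs0).const_mul (1 / η)
    have i1 : IntegrableOn (fun t => 1 / η * m t) (Ioo t₁ (t₁ + η)) :=
      (hmi.mono_set hs1).const_mul (1 / η)
    have e0 : ∫ t in Ioo (t₀ - η) t₀, 1 / η * m t =
        ∫ t in Ioo 0 T, (Ioo (t₀ - η) t₀).indicator (fun t => 1 / η * m t) t := by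
      rw [setIntegral_indicator measurableSet_Ioo, inter_eq_right.2 hs0]
    have e1 : ∫ t in Ioo t₁ (t₁ + η), 1 / η * m t =
        ∫ t in Ioo 0 T, (Ioo t₁ (t₁ + η)).indicator (fun t => 1 / η * m t) t := by
      rw [setIntegral_indicator measurableSet_Ioo, inter_eq_right.2 hs1]
    rw [e0, e1, ← integral_sub]
    · refine integral_congr_ae (ae_restrict_of_ae ?_)
      filter_upwards [deriv_trapezoid_ae t₀ t₁ hη] with t ht
      rw [ht, sub_mul]
      simp only [indicator_mul_left]
    · exact (i0.integrable_indicator measurableSet_Ioo).integrableOn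
    · exact (i1.integrable_indicator measurableSet_Ioo).integrableOn
  have b0 : ∫ t in Ioo (t₀ - η) t₀, 1 / η * m t ≤ m t₀ + ε / 2 := by
    have : ∫ t in Ioo (t₀ - η) t₀, 1 / η * m t ≤
        ∫ t in Ioo (t₀ - η) t₀, 1 / η * (m t₀ + ε / 2) := by
      refine setIntegral_mono_on ((hmi.mono_set hs0).const_mul _)
        (integrableOn_const (by simp)) measurableSet_Ioo
        fun t ht => mul_le_mul_of_nonneg_left ?_ (by positivity)
      have hd : dist t t₀ < δ₀ := by
        rw [Real.dist_eq, abs_lt]; constructor <;> linarith [ht.1, ht.2]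
      have := (abs_lt.1 (hm0 hd)).2
      linarith
    refine this.trans (le_of_eq ?_)
    rw [setIntegral_const, measureReal_def, Real.volume_Ioo, sub_sub_cancel,
      ENNReal.toReal_ofReal hη.le, smul_eq_mul]
    field_simp
  have b1 : m t₁ - ε / 2 ≤ ∫ t in Ioo t₁ (t₁ + η), 1 / η * m t := by
    have : ∫ t in Ioo t₁ (t₁ + η), 1 / η * (m t₁ - ε / 2) ≤
        ∫ t in Ioo t₁ (t₁ + η), 1 / η * m t := by
      refine setIntegral_mono_on (integrableOn_const (by simp))
        ((hmi.mono_set hs1).const_mul _) measurableSet_Ioo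
        fun t ht => mul_le_mul_of_nonneg_left ?_ (by positivity)
      have hd : dist t t₁ < δ₁ := by
        rw [Real.dist_eq, abs_lt]; constructor <;> linarith [ht.1, ht.2]
      have := (abs_lt.1 (hm1 hd)).1
      linarith
    refine (le_of_eq ?_).trans this
    rw [setIntegral_const, measureReal_def, Real.volume_Ioo, add_sub_cancel_left,
      ENNReal.toReal_ofReal hη.le, smul_eq_mul]
    field_simp
  rw [e]; linarith

variable {N : ℕ} {ψ : E N → ℝ} {χ : ℝ → ℝ}

/-- The gradient of `ψ² χ` is controlled by `ψ` itself. -/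
theorem norm_gradx_sq_mul_le {L : NNReal} (hψ0 : ∀ x, 0 ≤ ψ x) (hψL : LipschitzWith L ψ)
    (hχ0 : ∀ t, 0 ≤ χ t) (z : E N × ℝ) :
    ‖gradx (fun z => ψ z.1 ^ 2 * χ z.2) z‖ ≤ 2 * L * ψ z.1 * χ z.2 := by
  unfold gradx
  by_cases hd : DifferentiableAt ℝ (fun y => ψ y ^ 2 * χ z.2) z.1
  swap
  · rw [gradient_eq_zero_of_not_differentiableAt hd, norm_zero]
    have := hψ0 z.1
    have := hχ0 z.2
    positivity
  rw [gradient, LinearIsometryEquiv.norm_map]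
  -- `ψ` itself need not be differentiable, so the derivative is bounded by local Lipschitz
  -- constants: in `ψ(y)² - ψ(x)² = (ψ(y) - ψ(x))(ψ(y) + ψ(x))` the second factor tends to `2ψ(x)`.
  refine le_of_forall_pos_le_add fun ε hε => ?_
  have hψ0z := hψ0 z.1
  have hχ0z := hχ0 z.2
  refine hd.hasFDerivAt.le_of_lip' (by positivity) ?_
  have hcont : ContinuousAt (fun y => L * |ψ y - ψ z.1| * χ z.2) z.1 :=
    ((continuousAt_const.mul ((hψL.continuous.continuousAt.sub continuousAt_const).abs)).mul
      continuousAt_const)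
  have hev : ∀ᶠ y in 𝓝 z.1, L * |ψ y - ψ z.1| * χ z.2 < ε := by
    refine hcont.eventually_lt continuousAt_const ?_
    simpa using hε
  filter_upwards [hev] with y hy
  have h1 := hψL.dist_le_mul y z.1
  rw [Real.dist_eq, dist_eq_norm] at h1
  have h2 : ψ y + ψ z.1 ≤ 2 * ψ z.1 + |ψ y - ψ z.1| := by linarith [le_abs_self (ψ y - ψ z.1)]
  have h3 : 0 ≤ ψ y + ψ z.1 := add_nonneg (hψ0 y) (hψ0 z.1)
  calc ‖ψ y ^ 2 * χ z.2 - ψ z.1 ^ 2 * χ z.2‖ = |ψ y - ψ z.1| * (ψ y + ψ z.1) * χ z.2 := by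
        rw [← sub_mul, Real.norm_eq_abs, abs_mul, abs_of_nonneg hχ0z, sq_sub_sq, abs_mul,
          abs_of_nonneg h3]
        ring
    _ ≤ (L * ‖y - z.1‖) * (2 * ψ z.1 + |ψ y - ψ z.1|) * χ z.2 := by gcongr
    _ = (2 * L * ψ z.1 * χ z.2 + L * |ψ y - ψ z.1| * χ z.2) * ‖y - z.1‖ := by ring
    _ ≤ _ := by gcongr

theorem dt_sq_mul (z : E N × ℝ) :
    dt (fun z : E N × ℝ => ψ z.1 ^ 2 * χ z.2) z = ψ z.1 ^ 2 * deriv χ z.2 := by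
  simp only [dt, deriv_const_mul_field']

theorem lipC_sq_mul {L L' : NNReal} {Q : Set (E N × ℝ)} {P : Set (E N)} {J : Set ℝ}
    (hψ : ∀ x, ψ x ∈ Icc (0 : ℝ) 1) (hψL : LipschitzWith L ψ) (hψP : ∀ x ∉ P, ψ x = 0)
    (hχ : ∀ t, χ t ∈ Icc (0 : ℝ) 1) (hχL : LipschitzWith L' χ) (hχJ : ∀ t ∉ J, χ t = 0)
    (hP : IsCompact P) (hJ : IsCompact J) (hPQ : P ×ˢ J ⊆ Q) :
    LipC Q (fun z : E N × ℝ => ψ z.1 ^ 2 * χ z.2) := by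
  have h0 : ∀ z ∉ P ×ˢ J, ψ z.1 ^ 2 * χ z.2 = 0 := by
    intro z hz
    rw [mem_prod, not_and_or] at hz
    rcases hz with hz | hz
    · rw [hψP _ hz]; ring
    · rw [hχJ _ hz]; ring
  refine ⟨⟨2 * L + L', LipschitzWith.of_dist_le_mul fun z z' => ?_⟩,
    HasCompactSupport.intro (hP.prod hJ) h0, ?_⟩
  · have h1 := hψL.dist_le_mul z.1 z'.1
    have h2 := hχL.dist_le_mul z.2 z'.2
    have d1 : dist z.1 z'.1 ≤ dist z z' := le_max_left _ _
    have d2 : dist z.2 z'.2 ≤ dist z z' := le_max_right _ _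
    rw [Real.dist_eq] at h1 h2 ⊢
    obtain ⟨p1, p2⟩ := hψ z.1
    obtain ⟨p3, p4⟩ := hψ z'.1
    obtain ⟨q1, q2⟩ := hχ z.2
    obtain ⟨q3, q4⟩ := hχ z'.2
    have e : ψ z.1 ^ 2 * χ z.2 - ψ z'.1 ^ 2 * χ z'.2 =
        (ψ z.1 - ψ z'.1) * ((ψ z.1 + ψ z'.1) * χ z.2) + ψ z'.1 ^ 2 * (χ z.2 - χ z'.2) := by ring
    have b1 : |(ψ z.1 + ψ z'.1) * χ z.2| ≤ 2 := by
      rw [abs_of_nonneg (by positivity)]; nlinarith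
    have b2 : |ψ z'.1 ^ 2| ≤ 1 := by
      rw [abs_of_nonneg (by positivity)]; nlinarith
    rw [e]
    calc _ ≤ |ψ z.1 - ψ z'.1| * |(ψ z.1 + ψ z'.1) * χ z.2| + |ψ z'.1 ^ 2| * |χ z.2 - χ z'.2| := by
          rw [← abs_mul, ← abs_mul]; exact abs_add_le _ _
      _ ≤ (L * dist z z') * 2 + 1 * (L' * dist z z') := by
          gcongr
          · exact h1.trans (by gcongr)
          · exact h2.trans (by gcongr)
      _ = _ := by push_cast; ring
  · refine (closure_minimal (fun z hz => ?_) (hP.prod hJ).isClosed).trans hPQ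
    by_contra h
    exact hz (h0 z h)

end Cutoffs

/-! ### Local energy estimate. -/

section Energy

variable {N : ℕ} {Ω : Set (E N)} {T : ℝ} {a : ℝ → ℝ} {Λ : ℝ} {u : E N × ℝ → ℝ}

/-- Only convergence in measure of the slices is available. Every sequence of times has a
subsequence along which the slices converge almost everywhere, and dominated convergence concludes.
-/
theorem continuousOn_integral_slice (hu : IsWeakSol Ω T a Λ u) {P : Set (E N)}
    (hP : IsCompact P) (hPΩ : P ⊆ Ω) {f : ℝ → ℝ} (hf : Continuous f) {B : ℝ}
    (hB : ∀ s, |f s| ≤ B) {ρ : E N → ℝ} (hρ : Continuous ρ) (hρ1 : ∀ x, |ρ x| ≤ 1) :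
    ContinuousOn (fun t => ∫ x in P, ρ x * f (u (x, t))) (Icc 0 T) := by
  intro t₀ ht₀
  have hB0 : 0 ≤ B := (abs_nonneg _).trans (hB 0)
  refine tendsto_of_subseq_tendsto fun ts hts => ?_
  have hconv : TendstoInMeasure (volume.restrict P) (fun n x => u (x, ts n)) atTop
      (fun x => u (x, t₀)) := fun ε hε => (hu.cont t₀ ht₀ P hPΩ hP ε hε).comp hts
  obtain ⟨ms, hms, hae⟩ := hconv.exists_seq_tendsto_ae
  refine ⟨ms, tendsto_integral_filter_of_dominated_convergence (fun _ => B) ?_ ?_ ?_ ?_⟩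
  · have hmem : ∀ᶠ n in atTop, ts (ms n) ∈ Icc 0 T :=
      (hts.comp hms.tendsto_atTop).eventually eventually_mem_nhdsWithin
    filter_upwards [hmem] with n hn
    exact hρ.aestronglyMeasurable.mul
      (hf.comp_aestronglyMeasurable ((hu.meas_slice _ hn).mono_measure
        (Measure.restrict_mono hPΩ le_rfl)))
  · refine Eventually.of_forall fun n => Eventually.of_forall fun x => ?_
    rw [norm_mul]
    calc ‖ρ x‖ * ‖f (u (x, ts (ms n)))‖ ≤ 1 * B := by
          gcongr
          · exact hρ1 x
          · exact hB _
      _ = B := one_mul B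
  · exact integrableOn_const hP.measure_ne_top
  · filter_upwards [hae] with x hx
    exact ((hf.tendsto _).comp hx).const_mul (ρ x)

/-- Young's inequality for the flux. -/
theorem le_fluxTerm (ha : DiffusionCoeff a) (hΛ : 0 < Λ)
    (hle : ∀ s, 0 < s → Λ * (a s * I a s) ≤ 1) (g : E N × ℝ → E N) {φ : E N × ℝ → ℝ}
    {ψ χ L : ℝ} {z : E N × ℝ} (hχ : 0 ≤ χ) (hφ : φ z = ψ ^ 2 * χ)
    (hgrad : ‖gradx φ z‖ ≤ 2 * L * ψ * χ) :
    χ * (1 / 2 * (ψ ^ 2 * (deriv (F a Λ) (u z) * ‖g z‖ ^ 2))) ≤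
      fluxTerm a Λ u g φ z + χ * (2 * L ^ 2 / Λ * H a Λ (u z) ^ (Λ + 1)) := by
  have hF := F_nonneg ha hΛ (u z)
  have hF' := deriv_F_nonneg ha hΛ hle (u z)
  have hH := Real.rpow_nonneg (H_nonneg ha hΛ (u z)) (Λ + 1)
  have hsq := F_sq_le ha hΛ hle (u z)
  set f := F a Λ (u z)
  set f' := deriv (F a Λ) (u z)
  set h := H a Λ (u z) ^ (Λ + 1)
  have e : fluxTerm a Λ u g φ z =
      χ * (ψ ^ 2 * (f' * ‖g z‖ ^ 2)) + f * inner ℝ (g z) (gradx φ z) := by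
    simp only [fluxTerm, inner_add_right, inner_smul_right, real_inner_self_eq_norm_sq, hφ]
    ring
  have h1 : -(‖g z‖ * (2 * L * ψ * χ)) ≤ inner ℝ (g z) (gradx φ z) := by
    have := (abs_le.1 (abs_real_inner_le_norm (g z) (gradx φ z))).1
    have : ‖g z‖ * ‖gradx φ z‖ ≤ ‖g z‖ * (2 * L * ψ * χ) := by gcongr
    linarith
  -- Arithmetic-geometric mean inequality, checked after squaring, with `F_sq_le` supplying the
  -- product of the two terms on the right.
  have h2 : f * (‖g z‖ * (2 * L * ψ)) ≤
      1 / 2 * (ψ ^ 2 * (f' * ‖g z‖ ^ 2)) + 2 * L ^ 2 / Λ * h := by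
    refine le_of_sq_le_sq ?_ (by positivity)
    calc (f * (‖g z‖ * (2 * L * ψ))) ^ 2 = f ^ 2 * (‖g z‖ * (2 * L * ψ)) ^ 2 := by ring
      _ ≤ (1 / Λ * f' * h) * (‖g z‖ * (2 * L * ψ)) ^ 2 := by gcongr
      _ = 4 * ((1 / 2 * (ψ ^ 2 * (f' * ‖g z‖ ^ 2))) * (2 * L ^ 2 / Λ * h)) := by
        field_simp; ring
      _ ≤ _ := by nlinarith [sq_nonneg (1 / 2 * (ψ ^ 2 * (f' * ‖g z‖ ^ 2)) - 2 * L ^ 2 / Λ * h)]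
  have h3 := mul_le_mul_of_nonneg_left h1 hF
  have h4 := mul_le_mul_of_nonneg_left h2 hχ
  rw [e]
  nlinarith

theorem restrict_cyl (P : Set (E N)) (J : Set ℝ) :
    (volume : Measure (E N × ℝ)).restrict (P ×ˢ J) =
      (volume.restrict P).prod (volume.restrict J) := by
  rw [Measure.prod_restrict, Measure.volume_eq_prod]

/-- The local energy inequality. -/
theorem energy_inequality (hΩ : IsOpen Ω) (ha : DiffusionCoeff a) (hΛ : 0 < Λ)
    (hle : ∀ s, 0 < s → Λ * (a s * I a s) ≤ 1) (hu : IsWeakSol Ω T a Λ u) {M : ℝ}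
    (hM : ∀ᵐ z ∂(volume.restrict (cyl Ω T)), u z ≤ M) {g : E N × ℝ → E N}
    (hg : IsWeakGradx (cyl Ω T) u g)
    (hweak : ∀ φ : E N × ℝ → ℝ, LipC (cyl Ω T) φ → (∀ z, 0 ≤ φ z) →
      IntegrableOn (fluxTerm a Λ u g φ) (cyl Ω T) ∧
      ∫ z in cyl Ω T, fluxTerm a Λ u g φ z ≤ ∫ z in cyl Ω T, dt φ z * H a Λ (u z))
    {P : Set (E N)} (hP : IsCompact P) (hPΩ : P ⊆ Ω) {ψ : E N → ℝ} {L : NNReal}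
    (hψ : ∀ x, ψ x ∈ Icc (0 : ℝ) 1) (hψL : LipschitzWith L ψ) (hψP : ∀ x ∉ P, ψ x = 0)
    {t₀ t₁ s : ℝ} (ht₀ : 0 < t₀) (ht₀₁ : t₀ < t₁) (ht₁ : t₁ < s) (hs : s ≤ T) :
    IntegrableOn (fun z => ψ z.1 ^ 2 * (deriv (F a Λ) (u z) * ‖g z‖ ^ 2)) (P ×ˢ Ioo t₀ t₁) ∧
    (∫ x in P, ψ x ^ 2 * H a Λ (min (u (x, t₁)) M)) +
        1 / 2 * ∫ z in P ×ˢ Ioo t₀ t₁, ψ z.1 ^ 2 * (deriv (F a Λ) (u z) * ‖g z‖ ^ 2) ≤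
      (∫ x in P, ψ x ^ 2 * H a Λ (min (u (x, t₀)) M)) +
        2 * L ^ 2 / Λ * ∫ z in P ×ˢ Ioo 0 s, H a Λ (u z) ^ (Λ + 1) := by
  have hH0 := H_nonneg ha hΛ
  have hHc := H_continuous ha hΛ hle
  have hHm := H_monotone ha hΛ
  -- The bound `u ≤ M` holds almost everywhere in space-time, which says nothing about an individual
  -- slice. Truncating at `M` makes the slice integrals bounded and continuous without changing the
  -- space-time integrals.
  set f : ℝ → ℝ := fun s => H a Λ (min s M) with hf
  have hfc : Continuous f := hHc.comp (continuous_id.min continuous_const)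
  have hfB : ∀ s, |f s| ≤ H a Λ M := fun s => by
    rw [abs_of_nonneg (hH0 _)]; exact hHm (min_le_right _ _)
  set G : E N × ℝ → ℝ := fun z => ψ z.1 ^ 2 * (deriv (F a Λ) (u z) * ‖g z‖ ^ 2) with hG
  have hG0 : ∀ z, 0 ≤ G z := fun z =>
    mul_nonneg (sq_nonneg _) (mul_nonneg (deriv_F_nonneg ha hΛ hle _) (sq_nonneg _))
  have hψsq : ∀ x, |ψ x ^ 2| ≤ 1 := fun x => by
    rw [abs_of_nonneg (sq_nonneg _)]
    nlinarith [(hψ x).1, (hψ x).2]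
  set m : ℝ → ℝ := fun t => ∫ x in P, ψ x ^ 2 * f (u (x, t)) with hm
  have hmc : ContinuousOn m (Icc 0 T) :=
    continuousOn_integral_slice hu hP hPΩ hfc hfB (hψL.continuous.pow 2) hψsq
  set Y := ∫ z in P ×ˢ Ioo 0 s, H a Λ (u z) ^ (Λ + 1) with hY
  have hsubQ : ∀ J ⊆ Ioo 0 T, P ×ˢ J ⊆ cyl Ω T := fun J hJ => prod_mono hPΩ hJ
  have hPfin : ∀ J : Set ℝ, J ⊆ Ioo 0 T → volume (P ×ˢ J) ≠ ⊤ := fun J hJ => by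
    refine ne_top_of_le_ne_top ?_ (measure_mono (prod_mono (Subset.refl P)
      (hJ.trans Ioo_subset_Icc_self)))
    exact (hP.prod isCompact_Icc).measure_ne_top
  have huQ : AEStronglyMeasurable u (volume.restrict (cyl Ω T)) := hu.bounded.1
  have hQm : MeasurableSet (cyl Ω T) := hΩ.measurableSet.prod measurableSet_Ioo
  have hmeasJ : ∀ J ⊆ Ioo 0 T, AEStronglyMeasurable u (volume.restrict (P ×ˢ J)) := fun J hJ =>
    huQ.mono_measure (Measure.restrict_mono (hsubQ J hJ) le_rfl)
  have haeJ : ∀ J ⊆ Ioo 0 T, ∀ᵐ z ∂(volume.restrict (P ×ˢ J)), u z ≤ M := fun J hJ =>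
    ae_mono (Measure.restrict_mono (hsubQ J hJ) le_rfl) hM
  have hHint : ∀ J ⊆ Ioo 0 T, IntegrableOn (fun z => H a Λ (u z) ^ (Λ + 1)) (P ×ˢ J) := by
    intro J hJ
    refine Integrable.mono' (integrableOn_const (C := H a Λ M ^ (Λ + 1)) (hPfin J hJ)) ?_ ?_
    · exact (hHc.rpow_const fun _ => Or.inr (by positivity)).comp_aestronglyMeasurable
        (hmeasJ J hJ)
    · filter_upwards [haeJ J hJ] with z hz
      rw [Real.norm_of_nonneg (Real.rpow_nonneg (hH0 _) _)]
      exact Real.rpow_le_rpow (hH0 _) (hHm hz) (by positivity)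
  -- for each trapezoid
  have main : ∀ η, 0 < η → η < min t₀ (s - t₁) →
      IntegrableOn G (P ×ˢ Ioo t₀ t₁) ∧
      1 / 2 * (∫ z in P ×ˢ Ioo t₀ t₁, G z) - 2 * L ^ 2 / Λ * Y ≤
        ∫ t in Ioo 0 T, deriv (trapezoid t₀ t₁ η) t * m t := by
    intro η hη hηlt
    obtain ⟨hη0, hη1⟩ := lt_min_iff.1 hηlt
    set χ := trapezoid t₀ t₁ η with hχ
    set J := Icc (t₀ - η) (t₁ + η) with hJ
    have hJs : J ⊆ Ioo 0 s := fun t ht => ⟨by linarith [ht.1], by linarith [ht.2]⟩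
    have hJT : J ⊆ Ioo 0 T := hJs.trans (Ioo_subset_Ioo le_rfl hs)
    have hχ01 : ∀ t, χ t ∈ Icc (0 : ℝ) 1 := fun t => trapezoid_mem_Icc hη ht₀₁.le
    have hχJ : ∀ t ∉ J, χ t = 0 := fun t ht => trapezoid_eq_zero hη ht₀₁.le ht
    have hχL : LipschitzWith (1 / η.toNNReal + 1 / η.toNNReal) χ := by
      have := lipschitzWith_trapezoid t₀ t₁ η.toNNReal
      rwa [Real.coe_toNNReal η hη.le] at this
    set φ : E N × ℝ → ℝ := fun z => ψ z.1 ^ 2 * χ z.2 with hφ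
    have hLip : LipC (cyl Ω T) φ :=
      lipC_sq_mul hψ hψL hψP hχ01 hχL hχJ hP isCompact_Icc (hsubQ J hJT)
    obtain ⟨hfi, hfle⟩ := hweak φ hLip fun z => mul_nonneg (sq_nonneg _) (hχ01 z.2).1
    have hgrad : ∀ z, ‖gradx φ z‖ ≤ 2 * L * ψ z.1 * χ z.2 := fun z =>
      norm_gradx_sq_mul_le (fun x => (hψ x).1) hψL (fun t => (hχ01 t).1) z
    have hD : MeasurableSet (P ×ˢ J) := hP.measurableSet.prod measurableSet_Icc
    have hflux0 : ∀ z ∉ P ×ˢ J, fluxTerm a Λ u g φ z = 0 := by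
      intro z hz
      have h1 : ψ z.1 * χ z.2 = 0 := by
        rw [mem_prod, not_and_or] at hz
        rcases hz with hz | hz
        · rw [hψP _ hz, zero_mul]
        · rw [hχJ _ hz, mul_zero]
      have h2 : φ z = 0 := by
        rw [hφ]; dsimp only; rw [sq, mul_assoc, h1, mul_zero]
      have h3 : gradx φ z = 0 := by
        rw [← norm_le_zero_iff]
        refine (hgrad z).trans (le_of_eq ?_)
        rw [mul_assoc, h1, mul_zero]
      simp [fluxTerm, h2, h3]
    have hDQ := hsubQ J hJT
    have hfD : ∫ z in P ×ˢ J, fluxTerm a Λ u g φ z = ∫ z in cyl Ω T, fluxTerm a Λ u g φ z :=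
      (setIntegral_eq_of_subset_of_forall_sdiff_eq_zero hQm hDQ fun z hz => hflux0 z hz.2).symm
    have hptw : ∀ z, χ z.2 * (1 / 2 * G z) ≤
        fluxTerm a Λ u g φ z + χ z.2 * (2 * L ^ 2 / Λ * H a Λ (u z) ^ (Λ + 1)) := fun z =>
      le_fluxTerm ha hΛ hle g (hχ01 z.2).1 rfl (hgrad z)
    have hχmeas : Measurable fun z : E N × ℝ => χ z.2 :=
      hχL.continuous.measurable.comp measurable_snd
    have hbi : IntegrableOn (fun z => χ z.2 * (2 * L ^ 2 / Λ * H a Λ (u z) ^ (Λ + 1)))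
        (P ×ˢ J) := by
      refine ((hHint J hJT).const_mul _).bdd_mul (c := 1) hχmeas.aestronglyMeasurable ?_
      exact Eventually.of_forall fun z => by
        rw [Real.norm_of_nonneg (hχ01 z.2).1]; exact (hχ01 z.2).2
    have hGm : AEStronglyMeasurable G (volume.restrict (P ×ˢ J)) := by
      have h1 : AEStronglyMeasurable g (volume.restrict (P ×ˢ J)) :=
        (hg.memLp _ hDQ (hP.prod isCompact_Icc)).1
      have h2 : AEStronglyMeasurable (fun z => deriv (F a Λ) (u z))
          (volume.restrict (P ×ˢ J)) :=
        ((measurable_deriv _).comp_aemeasurable (hmeasJ J hJT).aemeasurable).aestronglyMeasurable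
      have h3 : Continuous fun z : E N × ℝ => ψ z.1 ^ 2 :=
        (hψL.continuous.comp continuous_fst).pow 2
      exact h3.aestronglyMeasurable.mul (h2.mul (h1.norm.pow 2))
    have hfiD : IntegrableOn (fluxTerm a Λ u g φ) (P ×ˢ J) := hfi.mono_set hDQ
    have hsumi := hfiD.add hbi
    -- Integrability of the dissipation is a conclusion here: it is dominated by the flux,
    -- integrable by the definition of a weak solution, plus a bounded term.
    have hGi : IntegrableOn (fun z => χ z.2 * (1 / 2 * G z)) (P ×ˢ J) := by
      refine Integrable.mono' hsumi
        (hχmeas.aestronglyMeasurable.mul (hGm.const_mul _)) (Eventually.of_forall fun z => ?_)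
      rw [Real.norm_of_nonneg]
      · exact hptw z
      · have := hG0 z; have := (hχ01 z.2).1; positivity
    have hsub : P ×ˢ Ioo t₀ t₁ ⊆ P ×ˢ J :=
      prod_mono le_rfl fun t ht => ⟨by linarith [ht.1], by linarith [ht.2]⟩
    have hmI : MeasurableSet (P ×ˢ Ioo t₀ t₁) := hP.measurableSet.prod measurableSet_Ioo
    have heq : EqOn (fun z => χ z.2 * (1 / 2 * G z)) (fun z => 1 / 2 * G z) (P ×ˢ Ioo t₀ t₁) := by
      intro z hz
      have : χ z.2 = 1 := trapezoid_eq_one hη hz.2.1.le hz.2.2.le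
      simp only [this, one_mul]
    have hGint : IntegrableOn (fun z => 1 / 2 * G z) (P ×ˢ Ioo t₀ t₁) :=
      (hGi.mono_set hsub).congr_fun heq hmI
    refine ⟨by simpa [IntegrableOn, mul_comm] using hGint.const_mul 2, ?_⟩
    -- lower bound
    have k1 : 1 / 2 * ∫ z in P ×ˢ Ioo t₀ t₁, G z ≤ ∫ z in P ×ˢ J, χ z.2 * (1 / 2 * G z) := by
      rw [← integral_const_mul, ← setIntegral_congr_fun hmI heq]
      refine setIntegral_mono_set hGi (Eventually.of_forall fun z => ?_) hsub.eventuallyLE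
      have := hG0 z; have := (hχ01 z.2).1
      simp only [Pi.zero_apply]; positivity
    have k2 : ∫ z in P ×ˢ J, χ z.2 * (1 / 2 * G z) ≤ (∫ z in cyl Ω T, fluxTerm a Λ u g φ z) +
        ∫ z in P ×ˢ J, χ z.2 * (2 * L ^ 2 / Λ * H a Λ (u z) ^ (Λ + 1)) := by
      rw [← hfD, ← integral_add hfiD hbi]
      exact integral_mono hGi hsumi hptw
    have k3 : ∫ z in P ×ˢ J, χ z.2 * (2 * L ^ 2 / Λ * H a Λ (u z) ^ (Λ + 1)) ≤
        2 * L ^ 2 / Λ * Y := by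
      rw [hY, ← integral_const_mul]
      have hi := (hHint (Ioo 0 s) (Ioo_subset_Ioo le_rfl hs)).const_mul (2 * L ^ 2 / Λ)
      have hnn : ∀ z, 0 ≤ 2 * L ^ 2 / Λ * H a Λ (u z) ^ (Λ + 1) := fun z => by
        have := Real.rpow_nonneg (hH0 (u z)) (Λ + 1); positivity
      refine (integral_mono hbi ((hHint J hJT).const_mul _) fun z => ?_).trans
        (setIntegral_mono_set hi (Eventually.of_forall hnn) (prod_mono le_rfl hJs).eventuallyLE)
      exact mul_le_of_le_one_left (hnn z) (hχ01 z.2).2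
    -- the time derivative
    have k4 : ∫ z in cyl Ω T, dt φ z * H a Λ (u z) = ∫ t in Ioo 0 T, deriv χ t * m t := by
      have hPT : P ×ˢ Ioo 0 T ⊆ cyl Ω T := hsubQ _ le_rfl
      have e1 : ∫ z in cyl Ω T, dt φ z * H a Λ (u z) =
          ∫ z in P ×ˢ Ioo 0 T, dt φ z * H a Λ (u z) := by
        refine setIntegral_eq_of_subset_of_forall_sdiff_eq_zero hQm hPT fun z hz => ?_
        have : z.1 ∉ P := fun h => hz.2 ⟨h, hz.1.2⟩
        rw [hφ, dt_sq_mul, hψP _ this]; ring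
      have e2 : ∫ z in P ×ˢ Ioo 0 T, dt φ z * H a Λ (u z) =
          ∫ z in P ×ˢ Ioo 0 T, deriv χ z.2 * (ψ z.1 ^ 2 * f (u z)) := by
        refine integral_congr_ae ?_
        filter_upwards [haeJ _ le_rfl] with z hz
        rw [hφ, dt_sq_mul, hf]
        simp only [min_eq_left hz]
        ring
      have hdi : Integrable (fun z : E N × ℝ => deriv χ z.2 * (ψ z.1 ^ 2 * f (u z)))
          (volume.restrict (P ×ˢ Ioo 0 T)) := by
        refine Integrable.mono' (integrableOn_const
          (C := (1 / η.toNNReal + 1 / η.toNNReal : NNReal) * (1 * H a Λ M))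
          (hPfin _ le_rfl)) ?_ (Eventually.of_forall fun z => ?_)
        · refine ((measurable_deriv χ).comp measurable_snd).aestronglyMeasurable.mul
            (Continuous.aestronglyMeasurable ?_ |>.mul
              (hfc.comp_aestronglyMeasurable (hmeasJ _ le_rfl)))
          exact (hψL.continuous.comp continuous_fst).pow 2
        · rw [norm_mul, norm_mul]
          gcongr
          · exact norm_deriv_le_of_lipschitz hχL
          · exact hψsq _
          · exact hfB _
      rw [e1, e2]
      rw [restrict_cyl] at hdi ⊢
      rw [integral_prod_symm _ hdi]
      simp only [integral_const_mul]
      rfl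
    rw [← k4]
    linarith
  have hη₀ : 0 < min t₀ (s - t₁) := lt_min ht₀ (by linarith)
  obtain ⟨η, h1, h2⟩ := exists_between hη₀
  refine ⟨(main η h1 h2).1, ?_⟩
  -- Letting the edges of the trapezoid shrink turns the time derivative into `m t₀ - m t₁`.
  have := le_sub_of_le_integral_deriv_trapezoid hmc ht₀ ht₀₁ (ht₁.trans_le hs) hη₀
    fun η h1 h2 => (main η h1 h2).2
  linarith

end Energy

/-! ### Nash-type inequality and interpolation. -/

section Interpolation

open scoped ENNReal

/-- A Nash-type inequality in space-time: a bound on the slices in `L¹` and on the `L¹` modulus of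
continuity in space gives a bound on a product. -/
theorem mul_lintegral_le_of_translates {N : ℕ} {w : E N × ℝ → ℝ≥0∞} {V : E N × ℝ → ℝ}
    (hw : Measurable w) (hV : Measurable V) {W c B D : ℝ≥0∞} (hwW : ∀ z, w z ≤ W)
    (hVw : ∀ z, ‖V z‖ₑ ≤ c * w z) {x₀ : E N} {R R' ρ : ℝ} (hR : R' + ρ ≤ R) {J : Set ℝ}
    (hJ : MeasurableSet J)
    (hslice : ∀ᵐ t ∂(volume.restrict J), ∫⁻ x in Metric.ball x₀ R, w (x, t) ≤ B)
    (htr : ∀ h ∈ Metric.ball (0 : E N) ρ,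
      ∫⁻ z in Metric.ball x₀ R' ×ˢ J, ‖V (z + (h, 0)) - V z‖ₑ ≤ D) :
    volume (Metric.ball (0 : E N) ρ) * ∫⁻ z in Metric.ball x₀ R' ×ˢ J, w z * ‖V z‖ₑ ≤
      W * (D * volume (Metric.ball (0 : E N) ρ)) + c * B * (volume J * B) := by
  rcases le_or_gt ρ 0 with hρ0 | hρ0
  · rw [Metric.ball_eq_empty.2 hρ0]; simp
  set A := Metric.ball x₀ R' with hA
  set β := Metric.ball (0 : E N) ρ with hβ
  have hsub : A ⊆ Metric.ball x₀ R := Metric.ball_subset_ball (by linarith)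
  have hVe : Measurable fun z => ‖V z‖ₑ := hV.enorm
  have hshift : Measurable fun p : (E N × ℝ) × E N => p.1 + (p.2, (0 : ℝ)) :=
    measurable_fst.add (measurable_snd.prodMk measurable_const)
  have hm1 : Measurable fun p : (E N × ℝ) × E N => ‖V (p.1 + (p.2, 0)) - V p.1‖ₑ :=
    ((hV.comp hshift).sub (hV.comp measurable_fst)).enorm
  have hm2 : Measurable fun p : (E N × ℝ) × E N => ‖V (p.1 + (p.2, 0))‖ₑ :=
    (hV.comp hshift).enorm
  have hd1 : Measurable fun z => ∫⁻ h in β, ‖V (z + (h, 0)) - V z‖ₑ := hm1.lintegral_prod_right'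
  have hd2 : Measurable fun z => ∫⁻ h in β, ‖V (z + (h, 0))‖ₑ := hm2.lintegral_prod_right'
  -- Integrate over `h` in the ball the estimate of `|V(z)|` by `|V(z+h) - V(z)| + |V(z+h)|`. The
  -- first term is handled by translations, the second by the slice bound.
  have hpt : ∀ z, volume β * (w z * ‖V z‖ₑ) ≤
      w z * (∫⁻ h in β, ‖V (z + (h, 0)) - V z‖ₑ) + w z * ∫⁻ h in β, ‖V (z + (h, 0))‖ₑ := by
    intro z
    have hm1z : Measurable fun h : E N => ‖V (z + (h, 0)) - V z‖ₑ :=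
      ((hV.comp (measurable_const.add (measurable_id.prodMk measurable_const))).sub
        measurable_const).enorm
    rw [← mul_add, ← lintegral_add_left hm1z, mul_left_comm]
    refine mul_le_mul' le_rfl ?_
    rw [mul_comm, ← setLIntegral_const]
    refine lintegral_mono fun h => ?_
    rw [← sub_sub_cancel (V (z + (h, 0))) (V z)]
    refine (enorm_sub_le).trans (le_of_eq ?_)
    rw [add_comm, sub_sub_cancel]
  have hws : ∫⁻ z in A ×ˢ J, w z ≤ volume J * B := by
    rw [restrict_cyl, lintegral_prod_symm' _ hw]
    calc ∫⁻ t in J, ∫⁻ x in A, w (x, t) ≤ ∫⁻ t in J, B := by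
          refine lintegral_mono_ae ?_
          filter_upwards [hslice] with t ht
          exact (lintegral_mono_set hsub).trans ht
      _ = _ := by rw [setLIntegral_const, mul_comm]
  have hwV : Measurable fun z => w z * ‖V z‖ₑ := hw.mul hVe
  rw [← lintegral_const_mul _ hwV]
  refine (lintegral_mono hpt).trans ?_
  have hwd : Measurable fun z => w z * ∫⁻ h in β, ‖V (z + (h, 0)) - V z‖ₑ := hw.mul hd1
  rw [lintegral_add_left hwd]
  refine add_le_add ?_ ?_
  · calc ∫⁻ z in A ×ˢ J, w z * ∫⁻ h in β, ‖V (z + (h, 0)) - V z‖ₑ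
        ≤ ∫⁻ z in A ×ˢ J, W * ∫⁻ h in β, ‖V (z + (h, 0)) - V z‖ₑ :=
          lintegral_mono fun z => by gcongr; exact hwW z
      _ = W * ∫⁻ z in A ×ˢ J, ∫⁻ h in β, ‖V (z + (h, 0)) - V z‖ₑ := lintegral_const_mul _ hd1
      _ = W * ∫⁻ h in β, ∫⁻ z in A ×ˢ J, ‖V (z + (h, 0)) - V z‖ₑ := by
          rw [lintegral_lintegral_swap hm1.aemeasurable]
      _ ≤ W * ∫⁻ h in β, D := by
          exact mul_le_mul' le_rfl (setLIntegral_mono' measurableSet_ball htr)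
      _ = _ := by rw [setLIntegral_const]
  · have hsl : ∀ᵐ z ∂((volume : Measure (E N × ℝ)).restrict (A ×ˢ J)),
        ∫⁻ h in β, ‖V (z + (h, 0))‖ₑ ≤ c * B := by
      have hset : MeasurableSet {z : E N × ℝ | z.1 ∈ A → ∫⁻ h in β, ‖V (z + (h, 0))‖ₑ ≤ c * B} :=
        (measurable_fst measurableSet_ball).imp (measurableSet_le hd2 measurable_const)
      have h1 : ∀ᵐ z ∂((volume : Measure (E N × ℝ)).restrict (A ×ˢ J)),
          z.1 ∈ A → ∫⁻ h in β, ‖V (z + (h, 0))‖ₑ ≤ c * B := by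
        rw [restrict_cyl, Measure.ae_prod_iff_ae_ae hset]
        -- The slice bound holds for almost every `t` and then serves all `x ∈ A` at once, so the
        -- time quantifier has to come first.
        refine Measure.ae_ae_comm hset |>.2 ?_
        filter_upwards [hslice] with t ht
        refine Eventually.of_forall fun x hx => ?_
        have e1 : ∫⁻ h in β, ‖V ((x, t) + (h, 0))‖ₑ = ∫⁻ h in β, ‖V (h + x, t)‖ₑ := by
          simp [add_comm]
        rw [e1]
        calc ∫⁻ h in β, ‖V (h + x, t)‖ₑ ≤ ∫⁻ y in Metric.ball x₀ R, ‖V (y, t)‖ₑ := by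
              rw [← lintegral_indicator measurableSet_ball,
                ← lintegral_indicator measurableSet_ball,
                ← lintegral_add_right_eq_self ((Metric.ball x₀ R).indicator _) x]
              refine lintegral_mono fun h => ?_
              by_cases hh : h ∈ β
              · have : h + x ∈ Metric.ball x₀ R := by
                  rw [Metric.mem_ball, dist_eq_norm] at hx ⊢
                  rw [hβ, mem_ball_zero_iff] at hh
                  calc ‖h + x - x₀‖ = ‖h + (x - x₀)‖ := by rw [add_sub_assoc]
                    _ ≤ ‖h‖ + ‖x - x₀‖ := norm_add_le _ _
                    _ < R := by linarith
                rw [indicator_of_mem hh, indicator_of_mem this]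
              · rw [indicator_of_notMem hh]
                exact zero_le
          _ ≤ ∫⁻ y in Metric.ball x₀ R, c * w (y, t) := lintegral_mono fun y => hVw _
          _ = c * ∫⁻ y in Metric.ball x₀ R, w (y, t) :=
              lintegral_const_mul _ (hw.comp measurable_prodMk_right)
          _ ≤ c * B := by gcongr
      filter_upwards [h1, ae_restrict_mem (measurableSet_ball.prod hJ)] with z hz hzA
        using hz hzA.1
    calc ∫⁻ z in A ×ˢ J, w z * ∫⁻ h in β, ‖V (z + (h, 0))‖ₑ
        ≤ ∫⁻ z in A ×ˢ J, w z * (c * B) := by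
          refine lintegral_mono_ae ?_
          filter_upwards [hsl] with z hz
          gcongr
      _ = (∫⁻ z in A ×ˢ J, w z) * (c * B) := lintegral_mul_const _ hw
      _ ≤ c * B * (volume J * B) := by rw [mul_comm]; gcongr

/-- Interpolation between the powers `1` and `q + 1`. -/
theorem rpow_le_interpolate {Λ q w l : ℝ} (hΛ : 0 < Λ) (hq : Λ ≤ q) (hw : 0 ≤ w) (hl : 0 < l) :
    w ^ (Λ + 1) ≤ l ^ Λ * w + l ^ (Λ - q) * w ^ (q + 1) := by
  rcases hw.eq_or_lt with rfl | hw0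
  · rw [Real.zero_rpow (by positivity), Real.zero_rpow (by linarith)]; simp
  have h1 := Real.rpow_pos_of_pos hl Λ
  have h2 := Real.rpow_pos_of_pos hl (Λ - q)
  have h3 := Real.rpow_pos_of_pos hw0 (q + 1)
  -- Below `l` the first term dominates, above `l` the second.
  rcases le_total w l with h | h
  · have : w ^ (Λ + 1) ≤ l ^ Λ * w := by
      rw [Real.rpow_add hw0, Real.rpow_one]
      gcongr
    nlinarith [mul_pos h2 h3]
  · have : w ^ (Λ + 1) ≤ l ^ (Λ - q) * w ^ (q + 1) := by
      have e : w ^ (Λ + 1) = w ^ (Λ - q) * w ^ (q + 1) := by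
        rw [← Real.rpow_add hw0]; congr 1; ring
      rw [e]
      exact mul_le_mul_of_nonneg_right (Real.rpow_le_rpow_of_nonpos hl h (by linarith)) h3.le
    nlinarith [mul_pos h1 hw0]

/-- Optimizing the radius and the interpolation parameter. -/
theorem exists_superlinear_bound (N : ℕ) {Λ q r T A₁ A₂ : ℝ} (hΛ : 0 < Λ) (hq : Λ ≤ q)
    (hr : 0 < r) (hT : 0 < T) (hA₁ : 0 < A₁) (hA₂ : 0 < A₂) :
    ∃ C : ℝ, 0 < C ∧ ∃ δ : ℝ, 0 < δ ∧ ∀ d B : ℝ, 0 < d → d ≤ r → 0 < B → B ≤ 1 →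
      ∃ ρ > 0, ρ ≤ d / 2 ∧ ∃ l > 0, ∀ X Z y : ℝ, X ≤ A₁ * ρ * B + A₂ * B ^ 2 / ρ ^ N → Z ≤ T * B →
        y ≤ l ^ Λ * Z + l ^ (Λ - q) * X → y ≤ C * (d ^ N)⁻¹ * B ^ (1 + δ) := by
  have hq0 : 0 < q := hΛ.trans_le hq
  -- With `ρ = (d/2) B^α` this exponent balances `ρ B` and `B²/ρ^N`, since `1 + α = 2 - Nα`.
  set α : ℝ := 1 / (N + 1) with hα
  have hα0 : 0 < α := by positivity
  -- With `l = B^κ` the factor `l^(Λ-q)` loses less than half of the gain `α`, while `l^Λ` gains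
  -- `κΛ`. Hence `δ = κΛ` works for both terms.
  set κ : ℝ := α / (2 * q) with hκ
  have hκ0 : 0 < κ := by positivity
  have hκq : κ * q = α / 2 := by rw [hκ]; field_simp
  have hκΛ : κ * Λ ≤ α / 2 := by rw [← hκq]; gcongr
  refine ⟨T * r ^ N + (A₁ * r ^ (N + 1) + A₂ * 2 ^ N), by positivity, κ * Λ, by positivity,
    fun d B hd hdr hB hB1 => ⟨d / 2 * B ^ α, by positivity, ?_, B ^ κ, by positivity,
      fun X Z y hX hZ hy => ?_⟩⟩
  · exact mul_le_of_le_one_right (by positivity) (Real.rpow_le_one hB.le hB1 hα0.le)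
  have e1 : A₁ * (d / 2 * B ^ α) * B ≤ A₁ * r ^ (N + 1) * (d ^ N)⁻¹ * B ^ (1 + α) := by
    rw [Real.rpow_add hB, Real.rpow_one]
    have : d / 2 ≤ r ^ (N + 1) * (d ^ N)⁻¹ := by
      rw [← div_eq_mul_inv, le_div_iff₀ (by positivity)]
      calc d / 2 * d ^ N ≤ d * d ^ N := by gcongr; linarith
        _ = d ^ (N + 1) := by ring
        _ ≤ r ^ (N + 1) := by gcongr
    calc A₁ * (d / 2 * B ^ α) * B = A₁ * (d / 2) * (B * B ^ α) := by ring
      _ ≤ A₁ * (r ^ (N + 1) * (d ^ N)⁻¹) * (B * B ^ α) := by gcongr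
      _ = _ := by ring
  have e2 : A₂ * B ^ 2 / (d / 2 * B ^ α) ^ N = A₂ * 2 ^ N * (d ^ N)⁻¹ * B ^ (1 + α) := by
    have h1 : B ^ (1 + α) * (B ^ α) ^ N = B ^ 2 := by
      rw [← Real.rpow_natCast (B ^ α), ← Real.rpow_mul hB.le, ← Real.rpow_add hB,
        ← Real.rpow_natCast B 2]
      congr 1
      rw [hα]; push_cast; field_simp; ring
    have := Real.rpow_pos_of_pos hB α
    rw [← h1, mul_pow, div_pow]
    field_simp
  have hX' : X ≤ (A₁ * r ^ (N + 1) + A₂ * 2 ^ N) * (d ^ N)⁻¹ * B ^ (1 + α) := by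
    rw [e2] at hX
    linarith
  have hz : (B ^ κ) ^ Λ * Z ≤ T * r ^ N * (d ^ N)⁻¹ * B ^ (1 + κ * Λ) := by
    have h1 : (1 : ℝ) ≤ r ^ N * (d ^ N)⁻¹ := by
      rw [← div_eq_mul_inv, le_div_iff₀ (by positivity), one_mul]; gcongr
    rw [← Real.rpow_mul hB.le, Real.rpow_add hB, Real.rpow_one]
    have hp := Real.rpow_pos_of_pos hB (κ * Λ)
    calc B ^ (κ * Λ) * Z ≤ B ^ (κ * Λ) * (T * B) := by gcongr
      _ = T * 1 * (B * B ^ (κ * Λ)) := by ring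
      _ ≤ T * (r ^ N * (d ^ N)⁻¹) * (B * B ^ (κ * Λ)) := by gcongr
      _ = _ := by ring
  have hx : (B ^ κ) ^ (Λ - q) * X ≤
      (A₁ * r ^ (N + 1) + A₂ * 2 ^ N) * (d ^ N)⁻¹ * B ^ (1 + κ * Λ) := by
    rw [← Real.rpow_mul hB.le]
    have hp := Real.rpow_pos_of_pos hB (κ * (Λ - q))
    calc B ^ (κ * (Λ - q)) * X ≤ B ^ (κ * (Λ - q)) *
          ((A₁ * r ^ (N + 1) + A₂ * 2 ^ N) * (d ^ N)⁻¹ * B ^ (1 + α)) := by gcongr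
      _ = (A₁ * r ^ (N + 1) + A₂ * 2 ^ N) * (d ^ N)⁻¹ * (B ^ (κ * (Λ - q)) * B ^ (1 + α)) := by
          ring
      _ ≤ _ := by
          rw [← Real.rpow_add hB]
          refine mul_le_mul_of_nonneg_left ?_ (by positivity)
          refine Real.rpow_le_rpow_of_exponent_ge hB hB1 ?_
          nlinarith
  linarith

end Interpolation

/-! ### Integrable representatives of the weak gradient. -/

section WeakGradient

variable {N : ℕ}

theorem inner_gradx {ψ : E N × ℝ → ℝ} (hψ : ContDiff ℝ ∞ ψ) (z : E N × ℝ) (h : E N) :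
    inner ℝ h (gradx ψ z) = fderiv ℝ ψ z (h, 0) := by
  have hd : HasFDerivAt ψ (fderiv ℝ ψ z) (z.1, z.2) :=
    (hψ.differentiable (by simp) z).hasFDerivAt
  have h1 : HasFDerivAt (fun y : E N => (y, z.2)) (ContinuousLinearMap.inl ℝ (E N) ℝ) z.1 := by
    simpa using! (hasFDerivAt_id z.1).prodMk (hasFDerivAt_const z.2 z.1)
  have h2 : HasFDerivAt (fun y => ψ (y, z.2)) _ z.1 := hd.comp z.1 h1
  rw [gradx, real_inner_comm, gradient, InnerProductSpace.toDual_symm_apply, h2.fderiv]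
  rfl

/-- A globally integrable Borel version of a weak gradient on a compact set. -/
theorem exists_integrable_weak_gradient {Q D : Set (E N × ℝ)} {u v : E N × ℝ → ℝ}
    {g : E N × ℝ → E N} (hQ : MeasurableSet Q) (hg : IsWeakGradx Q u g)
    (hvu : ∀ᵐ z ∂(volume.restrict Q), v z = u z) (hv : Measurable v) {M : ℝ}
    (hM : ∀ z, |v z| ≤ M) (hD : IsCompact D) (hDQ : D ⊆ Q) :
    ∃ G : E N × ℝ → E N, Measurable G ∧ Integrable G ∧
      (∀ᵐ z ∂(volume.restrict D), G z = g z) ∧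
      ∀ h : E N, ∀ ψ : E N × ℝ → ℝ, ContDiff ℝ ∞ ψ → HasCompactSupport ψ → tsupport ψ ⊆ D →
        ∫ z, v z * fderiv ℝ ψ z (h, 0) = - ∫ z, ψ z * inner ℝ h (G z) := by
  have hgD := hg.memLp D hDQ hD
  have hfin : IsFiniteMeasure ((volume : Measure (E N × ℝ)).restrict D) :=
    ⟨by simpa using hD.measure_lt_top⟩
  have hgi : IntegrableOn g D := hgD.integrable (by norm_num)
  set G₀ := hgD.1.mk g with hG₀
  have hG₀m : Measurable G₀ := hgD.1.stronglyMeasurable_mk.measurable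
  have hG₀e : g =ᵐ[volume.restrict D] G₀ := hgD.1.ae_eq_mk
  have hDm := hD.measurableSet
  have hG₀i : IntegrableOn G₀ D := hgi.congr hG₀e
  -- Extension by zero is harmless, as the test functions are supported in `D`.
  refine ⟨D.indicator G₀, hG₀m.indicator hDm, hG₀i.integrable_indicator hDm, ?_, ?_⟩
  · filter_upwards [hG₀e, ae_restrict_mem hDm] with z hz hzD
    rw [indicator_of_mem hzD, hz]
  intro h ψ hψ hψc hψD
  have hψ0 : ∀ z ∉ D, ψ z = 0 := fun z hz => image_eq_zero_of_notMem_tsupport fun h => hz (hψD h)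
  have hfd : ∀ z ∉ D, fderiv ℝ ψ z = 0 := fun z hz => by
    have : z ∉ tsupport (fderiv ℝ ψ) := fun h => hz (hψD (tsupport_fderiv_subset ℝ h))
    exact image_eq_zero_of_notMem_tsupport this
  have hgr : ∀ z ∉ D, gradx ψ z = 0 := fun z hz => by
    refine ext_inner_left ℝ fun y => ?_
    rw [inner_gradx hψ, hfd z hz]; simp
  have hw := congrArg (inner ℝ h) (hg.weak ψ hψ hψc (hψD.trans hDQ))
  obtain ⟨B, hB⟩ := hψc.exists_bound_of_continuous hψ.continuous
  obtain ⟨B', hB'⟩ := (hψc.fderiv ℝ).exists_bound_of_continuous (hψ.continuous_fderiv (by simp))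
  have i2 : Integrable (fun z => ψ z • g z) (volume.restrict Q) := by
    have h1 : IntegrableOn (fun z => ψ z • g z) D := by
      exact hgi.bdd_smul B hψ.continuous.aestronglyMeasurable (Eventually.of_forall hB)
    refine (h1.integrable_of_forall_notMem_eq_zero fun z hz => ?_).integrableOn
    rw [hψ0 z hz, zero_smul]
  have hgmeas : Measurable (gradx ψ) := by
    have e : gradx ψ = fun z => (InnerProductSpace.toDual ℝ (E N)).symm
        ((fderiv ℝ ψ z).comp (ContinuousLinearMap.inl ℝ (E N) ℝ)) := by
      funext z
      refine ext_inner_left ℝ fun y => ?_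
      rw [inner_gradx hψ, real_inner_comm, InnerProductSpace.toDual_symm_apply]
      simp
    rw [e]
    refine Continuous.measurable ?_
    exact (LinearIsometryEquiv.continuous _).comp
      ((hψ.continuous_fderiv (by simp)).clm_comp continuous_const)
  have hgb : ∀ z, ‖gradx ψ z‖ ≤ B' := fun z => by
    have h1 : ‖gradx ψ z‖ * ‖gradx ψ z‖ ≤ B' * ‖gradx ψ z‖ := by
      rw [← real_inner_self_eq_norm_mul_norm, inner_gradx hψ]
      refine (Real.le_norm_self _).trans ((ContinuousLinearMap.le_opNorm _ _).trans ?_)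
      exact mul_le_mul (hB' z) (by simp [Prod.norm_def]) (norm_nonneg _)
        ((norm_nonneg _).trans (hB' z))
    by_contra hc
    rw [not_le] at hc
    have : 0 ≤ B' := (norm_nonneg _).trans (hB' z)
    nlinarith
  have hvi : IntegrableOn (fun z => v z • gradx ψ z) D := by
    refine Integrable.mono' (integrableOn_const (C := M * B') hD.measure_ne_top)
      (hv.aestronglyMeasurable.smul hgmeas.aestronglyMeasurable) (Eventually.of_forall fun z => ?_)
    rw [norm_smul]
    exact mul_le_mul (hM z) (hgb z) (norm_nonneg _) ((abs_nonneg _).trans (hM z))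
  have i1' : Integrable (fun z => v z • gradx ψ z) :=
    hvi.integrable_of_forall_notMem_eq_zero fun z hz => by rw [hgr z hz, smul_zero]
  have hvu' : ∫ z in Q, u z • gradx ψ z = ∫ z in Q, v z • gradx ψ z := by
    refine integral_congr_ae ?_
    filter_upwards [hvu] with z hz
    rw [hz]
  rw [hvu', inner_neg_right, ← integral_inner i1'.integrableOn, ← integral_inner i2] at hw
  simp only [inner_smul_right] at hw
  have e1 : ∫ z in Q, v z * inner ℝ h (gradx ψ z) = ∫ z, v z * fderiv ℝ ψ z (h, 0) := by
    simp only [inner_gradx hψ]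
    refine setIntegral_eq_integral_of_forall_compl_eq_zero fun z hz => ?_
    rw [hfd z fun h => hz (hDQ h)]; simp
  have e2 : ∫ z in Q, ψ z * inner ℝ h (g z) = ∫ z, ψ z * inner ℝ h (D.indicator G₀ z) := by
    rw [setIntegral_eq_of_subset_of_forall_sdiff_eq_zero hQ hDQ
      (fun z hz => by rw [hψ0 z hz.2, zero_mul])]
    refine Eq.trans ?_ (setIntegral_eq_integral_of_forall_compl_eq_zero (s := D)
      (fun z hz => by rw [hψ0 z hz, zero_mul]))
    refine integral_congr_ae ?_
    filter_upwards [hG₀e, ae_restrict_mem hDm] with z hz hzD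
    rw [indicator_of_mem hzD, hz]
  rw [← e1, ← e2, hw]

end WeakGradient

/-! ### From energy bounds to a superlinear estimate. -/

section DecayStep

open scoped ENNReal

variable {N : ℕ}

/-- The support stays in a closed ball inside the open ball of radius `R`. The gap between `R - d`
and `R - d/2`, where the cutoff is `1`, is left for translations of length at most `d/2`. -/
theorem exists_cutoff (x₀ : E N) (R : ℝ) {d : ℝ} (hd : 0 < d) :
    ∃ ψ : E N → ℝ, (∀ x, ψ x ∈ Icc (0 : ℝ) 1) ∧ LipschitzWith (1 / (d / 4).toNNReal) ψ ∧
      (∀ x ∉ Metric.closedBall x₀ (R - d / 4), ψ x = 0) ∧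
      ∀ x ∈ Metric.ball x₀ (R - d / 2), ψ x = 1 := by
  have hd4 : 0 < d / 4 := by positivity
  refine ⟨fun x => ramp (-(R - d / 4)) (d / 4) (-dist x x₀), fun x => ⟨ramp_nonneg, ramp_le_one⟩,
    ?_, fun x hx => ramp_of_le hd4 ?_, fun x hx => ramp_of_ge hd4 ?_⟩
  · have h1 := lipschitzWith_ramp (-(R - d / 4)) (d / 4).toNNReal
    rw [Real.coe_toNNReal _ hd4.le] at h1
    have h2 : LipschitzWith 1 fun x : E N => -dist x x₀ := (LipschitzWith.dist_left x₀).neg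
    simpa using! h1.comp h2
  · rw [Metric.mem_closedBall, not_le] at hx; linarith
  · rw [Metric.mem_ball] at hx; linarith

theorem integrableOn_of_abs_le {S : Set (E N × ℝ)} (hS : volume S ≠ ⊤) {f : E N × ℝ → ℝ}
    (hf : Measurable f) {c : ℝ} (hc : ∀ z, |f z| ≤ c) : IntegrableOn f S :=
  Integrable.mono' (integrableOn_const (C := c) hS) hf.aestronglyMeasurable
    (Eventually.of_forall hc)

theorem volume_ball_eq (x₀ : E N) {ρ : ℝ} (hρ : 0 < ρ) :
    volume (Metric.ball x₀ ρ) =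
      ENNReal.ofReal (ρ ^ N * (volume (Metric.ball (0 : E N) 1)).toReal) := by
  rw [Measure.addHaar_ball_of_pos _ _ hρ, ENNReal.ofReal_mul (by positivity),
    ENNReal.ofReal_toReal measure_ball_lt_top.ne]
  simp

theorem volume_unitBall_pos : 0 < (volume (Metric.ball (0 : E N) 1)).toReal :=
  ENNReal.toReal_pos (Metric.measure_ball_pos _ _ one_pos).ne' measure_ball_lt_top.ne

theorem ae_slice {Ω : Set (E N)} {J : Set ℝ} {p : E N × ℝ → Prop}
    (h : ∀ᵐ z ∂((volume : Measure (E N × ℝ)).restrict (Ω ×ˢ J)), p z) :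
    ∀ᵐ t ∂(volume.restrict J), ∀ᵐ x ∂(volume.restrict Ω), p (x, t) := by
  rw [restrict_cyl] at h
  exact Measure.ae_ae_of_ae_prod (Measure.measurePreserving_swap.quasiMeasurePreserving.ae h)

/-- The quantity iterated in the proof of finite propagation speed. -/
def mass (a : ℝ → ℝ) (Λ : ℝ) (v : E N × ℝ → ℝ) (x₀ : E N) (s R : ℝ) : ℝ :=
  ∫ z in Metric.ball x₀ R ×ˢ Ioo 0 s, H a Λ (v z) ^ (Λ + 1)

theorem volume_cyl_ne_top (x₀ : E N) (R t₀ t₁ : ℝ) :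
    volume (Metric.ball x₀ R ×ˢ Ioo t₀ t₁) ≠ ⊤ := by
  rw [Measure.volume_eq_prod, Measure.prod_prod]
  exact ENNReal.mul_ne_top measure_ball_lt_top.ne (by simp)

/-- The superlinear estimate, away from the initial time, given the energy bounds. -/
theorem interior_decay {a : ℝ → ℝ} {Λ : ℝ} (ha : DiffusionCoeff a) (hΛ : 0 < Λ)
    (hle : ∀ s, 0 < s → Λ * (a s * I a s) ≤ 1) {M : ℝ} (hM0 : 0 < M)
    {v : E N × ℝ → ℝ} (hv : Measurable v) (hv0 : ∀ z, 0 ≤ v z) (hvM : ∀ z, v z ≤ M)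
    {q : ℝ} (hq1 : 1 ≤ q) (hqΛ : Λ ≤ q) {k : ℝ → ℝ} (hk : Continuous k)
    (hK : ∀ s, HasDerivAt (fun s => H a Λ s ^ q) (k s) s) {Ck : ℝ} (hCk : 0 < Ck)
    (hkM : ∀ s ≤ M, k s ^ 2 ≤ Ck * (deriv (F a Λ) s * H a Λ s))
    {x₀ : E N} {R R' ρ t₀ t₁ T B l : ℝ} (hρ : 0 < ρ) (hR : R' + ρ ≤ R) (ht : t₀ < t₁)
    (htT : t₁ - t₀ ≤ T) (hB : 0 < B) (hl : 0 < l) {G : E N × ℝ → E N} (hGm : Measurable G)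
    (hGi : Integrable G)
    (hGw : ∀ h : E N, ∀ ψ : E N × ℝ → ℝ, ContDiff ℝ ∞ ψ → HasCompactSupport ψ →
      tsupport ψ ⊆ Metric.ball x₀ R ×ˢ Ioo t₀ t₁ →
        ∫ z, v z * fderiv ℝ ψ z (h, 0) = - ∫ z, ψ z * inner ℝ h (G z))
    (hslice : ∀ᵐ t ∂(volume.restrict (Ioo t₀ t₁)),
      ∫⁻ x in Metric.ball x₀ R, ENNReal.ofReal (H a Λ (v (x, t))) ≤ ENNReal.ofReal B)
    (hgrad : ∫⁻ z in Metric.ball x₀ R ×ˢ Ioo t₀ t₁,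
      ENNReal.ofReal (deriv (F a Λ) (v z) * ‖G z‖ ^ 2) ≤ ENNReal.ofReal (2 * B)) :
    ∃ X Z : ℝ, X ≤ (H a Λ M * (1 + Ck * T / 2)) * ρ * B +
        (H a Λ M ^ (q - 1) * T / (volume (Metric.ball (0 : E N) 1)).toReal) * B ^ 2 / ρ ^ N ∧
      Z ≤ T * B ∧
      ∫ z in Metric.ball x₀ R' ×ˢ Ioo t₀ t₁, H a Λ (v z) ^ (Λ + 1) ≤
        l ^ Λ * Z + l ^ (Λ - q) * X := by
  have hT : 0 < T := by linarith
  have hq0 : 0 < q := by linarith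
  have hH0 := H_nonneg ha hΛ
  have hHc := H_continuous ha hΛ hle
  have hHm := H_monotone ha hΛ
  have hW := H_pos ha hΛ hM0
  set W := H a Λ M with hWdef
  have hHW : ∀ z, H a Λ (v z) ≤ W := fun z => hHm (hvM z)
  have hwm : Measurable fun z => H a Λ (v z) := hHc.measurable.comp hv
  have hpow : ∀ p : ℝ, 0 ≤ p → Measurable fun z => H a Λ (v z) ^ p := fun p hp =>
    (hHc.rpow_const fun _ => Or.inr hp).measurable.comp hv
  have hpowb : ∀ p : ℝ, 0 ≤ p → ∀ z, |H a Λ (v z) ^ p| ≤ W ^ p := fun p hp z => by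
    rw [abs_of_nonneg (Real.rpow_nonneg (hH0 _) _)]
    exact Real.rpow_le_rpow (hH0 _) (hHW z) hp
  set J := Ioo t₀ t₁ with hJ
  set O := Metric.ball x₀ R with hO
  set A := Metric.ball x₀ R' with hA
  set ϖ := (volume (Metric.ball (0 : E N) 1)).toReal with hϖ
  have hϖ0 : 0 < ϖ := volume_unitBall_pos
  have hsub : A ⊆ O := Metric.ball_subset_ball (by linarith)
  have hVJ : volume J ≤ ENNReal.ofReal T := by
    rw [hJ, Real.volume_Ioo]; exact ENNReal.ofReal_le_ofReal htT
  have hwe : Measurable fun z => ENNReal.ofReal (H a Λ (v z)) := hwm.ennreal_ofReal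
  have hZ : ∫⁻ z in O ×ˢ J, ENNReal.ofReal (H a Λ (v z)) ≤ ENNReal.ofReal (T * B) := by
    rw [restrict_cyl, lintegral_prod_symm' _ hwe]
    calc ∫⁻ t in J, ∫⁻ x in O, ENNReal.ofReal (H a Λ (v (x, t)))
        ≤ ∫⁻ t in J, ENNReal.ofReal B := lintegral_mono_ae hslice
      _ = ENNReal.ofReal B * volume J := setLIntegral_const _ _
      _ ≤ ENNReal.ofReal B * ENNReal.ofReal T := by gcongr
      _ = _ := by rw [← ENNReal.ofReal_mul hB.le, mul_comm]
  -- translations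
  set D := ρ * (1 + Ck * T / 2) * B with hD
  have htr : ∀ h ∈ Metric.ball (0 : E N) ρ,
      ∫⁻ z in A ×ˢ J, ‖H a Λ (v (z + (h, 0))) ^ q - H a Λ (v z) ^ q‖ₑ ≤ ENNReal.ofReal D := by
    intro h hh
    rw [mem_ball_zero_iff] at hh
    have hγm : Measurable fun z => inner ℝ h (G z) := by
      have : Continuous fun y : E N => inner ℝ h y := by fun_prop
      exact this.measurable.comp hGm
    have hγi : Integrable fun z => inner ℝ h (G z) := hGi.const_inner h
    have : (volume : Measure (E N × ℝ)).IsAddHaarMeasure := by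
      rw [Measure.volume_eq_prod]; infer_instance
    have h1 := lintegral_comp_translate_sub_le (μ := (volume : Measure (E N × ℝ))) hv
      (M := M) (fun z => by rw [abs_of_nonneg (hv0 z)]; exact hvM z) hγm hγi
      (e := (h, 0)) (O := O ×ˢ J) (A := A ×ˢ J) (hGw h)
      (Metric.isOpen_ball.prod isOpen_Ioo) (measurableSet_ball.prod measurableSet_Ioo) ?_ hk hK
    · refine h1.trans ?_
      have hpt : ∀ z, ‖k (v z) * inner ℝ h (G z)‖ₑ ≤
          ENNReal.ofReal (ρ / 2) * (ENNReal.ofReal (deriv (F a Λ) (v z) * ‖G z‖ ^ 2) +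
            ENNReal.ofReal Ck * ENNReal.ofReal (H a Λ (v z))) := by
        intro z
        have hF' := deriv_F_nonneg ha hΛ hle (v z)
        have hHz := hH0 (v z)
        rw [← ENNReal.ofReal_mul hCk.le, ← ENNReal.ofReal_add (by positivity) (by positivity),
          ← ENNReal.ofReal_mul (by positivity), ← ofReal_norm]
        refine ENNReal.ofReal_le_ofReal ?_
        have hin : |inner ℝ h (G z)| ≤ ρ * ‖G z‖ :=
          (abs_real_inner_le_norm _ _).trans (by gcongr)
        -- Here `k² ≤ Ck F' H` splits the gradient of `H^q` into dissipation and mass.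
        have hy : |k (v z)| * ‖G z‖ ≤
            (deriv (F a Λ) (v z) * ‖G z‖ ^ 2 + Ck * H a Λ (v z)) / 2 := by
          refine le_of_sq_le_sq ?_ (by positivity)
          have h2 := hkM (v z) (hvM z)
          calc (|k (v z)| * ‖G z‖) ^ 2 = k (v z) ^ 2 * ‖G z‖ ^ 2 := by rw [mul_pow, sq_abs]
            _ ≤ Ck * (deriv (F a Λ) (v z) * H a Λ (v z)) * ‖G z‖ ^ 2 := by gcongr
            _ = (deriv (F a Λ) (v z) * ‖G z‖ ^ 2) * (Ck * H a Λ (v z)) := by ring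
            _ ≤ _ := by
              nlinarith [sq_nonneg (deriv (F a Λ) (v z) * ‖G z‖ ^ 2 - Ck * H a Λ (v z))]
        rw [Real.norm_eq_abs, abs_mul]
        calc |k (v z)| * |inner ℝ h (G z)| ≤ |k (v z)| * (ρ * ‖G z‖) := by gcongr
          _ = ρ * (|k (v z)| * ‖G z‖) := by ring
          _ ≤ ρ * ((deriv (F a Λ) (v z) * ‖G z‖ ^ 2 + Ck * H a Λ (v z)) / 2) := by gcongr
          _ = _ := by ring
      have hm1 : Measurable fun z => ENNReal.ofReal (deriv (F a Λ) (v z) * ‖G z‖ ^ 2) :=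
        (((measurable_deriv _).comp hv).mul (hGm.norm.pow_const 2)).ennreal_ofReal
      have hm2 : Measurable fun z => ENNReal.ofReal Ck * ENNReal.ofReal (H a Λ (v z)) :=
        hwe.const_mul _
      have hm3 : Measurable fun z => ENNReal.ofReal (deriv (F a Λ) (v z) * ‖G z‖ ^ 2) +
        ENNReal.ofReal Ck * ENNReal.ofReal (H a Λ (v z)) := hm1.add hm2
      refine (lintegral_mono hpt).trans ?_
      rw [lintegral_const_mul _ hm3, lintegral_add_left hm1, lintegral_const_mul _ hwe]
      calc _ ≤ ENNReal.ofReal (ρ / 2) * (ENNReal.ofReal (2 * B) +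
            ENNReal.ofReal Ck * ENNReal.ofReal (T * B)) := by gcongr
        _ = ENNReal.ofReal D := by
          rw [← ENNReal.ofReal_mul hCk.le, ← ENNReal.ofReal_add (by positivity) (by positivity),
            ← ENNReal.ofReal_mul (by positivity), hD]
          congr 1; ring
    · rintro σ hσ z ⟨hz1, hz2⟩
      refine ⟨?_, by simpa using hz2⟩
      have hz1' : dist z.1 x₀ < R' := hz1
      rw [dist_eq_norm] at hz1'
      change z.1 + σ • h ∈ Metric.ball x₀ R
      rw [Metric.mem_ball, dist_eq_norm, add_sub_right_comm]
      calc ‖z.1 - x₀ + σ • h‖ ≤ ‖z.1 - x₀‖ + ‖σ • h‖ := norm_add_le _ _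
        _ ≤ ‖z.1 - x₀‖ + 1 * ‖h‖ := by
          rw [norm_smul, Real.norm_of_nonneg hσ.1]; gcongr; exact hσ.2
        _ < R := by linarith
  have hVw : ∀ z, ‖H a Λ (v z) ^ q‖ₑ ≤ ENNReal.ofReal (W ^ (q - 1)) *
      ENNReal.ofReal (H a Λ (v z)) := by
    intro z
    rw [← ENNReal.ofReal_mul (by positivity), ← ofReal_norm,
      Real.norm_of_nonneg (Real.rpow_nonneg (hH0 _) _)]
    refine ENNReal.ofReal_le_ofReal ?_
    rcases (hH0 (v z)).eq_or_lt with h | h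
    · rw [← h, Real.zero_rpow hq0.ne', mul_zero]
    · rw [← sub_add_cancel q 1, Real.rpow_add h, Real.rpow_one, add_sub_cancel_right]
      exact mul_le_mul_of_nonneg_right (Real.rpow_le_rpow h.le (hHW z) (by linarith)) h.le
  -- The choice `w = H(v)`, `V = H(v)^q` makes the product `H(v)^(q+1)`.
  have key := mul_lintegral_le_of_translates hwe (hpow q hq0.le)
    (fun z => ENNReal.ofReal_le_ofReal (hHW z)) hVw hR measurableSet_Ioo hslice htr
  have hAJ : volume (A ×ˢ J) ≠ ⊤ := volume_cyl_ne_top _ _ _ _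
  refine ⟨∫ z in A ×ˢ J, H a Λ (v z) ^ (q + 1), ∫ z in A ×ˢ J, H a Λ (v z), ?_, ?_, ?_⟩
  · set X := ∫ z in A ×ˢ J, H a Λ (v z) ^ (q + 1) with hX
    have eX : ∫⁻ z in A ×ˢ J, ENNReal.ofReal (H a Λ (v z)) * ‖H a Λ (v z) ^ q‖ₑ =
        ENNReal.ofReal X := by
      rw [hX, ofReal_integral_eq_lintegral_ofReal
        (integrableOn_of_abs_le hAJ (hpow _ (by linarith)) (hpowb _ (by linarith)))
        (Eventually.of_forall fun z => Real.rpow_nonneg (hH0 _) _)]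
      refine lintegral_congr fun z => ?_
      rw [← ofReal_norm, Real.norm_of_nonneg (Real.rpow_nonneg (hH0 _) _),
        ← ENNReal.ofReal_mul (hH0 _), Real.rpow_add_one' (hH0 _) (by linarith), mul_comm]
    rw [eX, volume_ball_eq _ hρ, ← hϖ] at key
    have key2 : ENNReal.ofReal (ρ ^ N * ϖ) * ENNReal.ofReal X ≤
        ENNReal.ofReal W * (ENNReal.ofReal D * ENNReal.ofReal (ρ ^ N * ϖ)) +
        ENNReal.ofReal (W ^ (q - 1)) * ENNReal.ofReal B *
          (ENNReal.ofReal T * ENNReal.ofReal B) := by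
      refine key.trans ?_
      gcongr
    have hWq : 0 < W ^ (q - 1) := Real.rpow_pos_of_pos hW _
    have hD0 : 0 < D := by positivity
    rw [← ENNReal.ofReal_mul (by positivity), ← ENNReal.ofReal_mul (by positivity),
      ← ENNReal.ofReal_mul (by positivity), ← ENNReal.ofReal_mul (by positivity),
      ← ENNReal.ofReal_mul (by positivity), ← ENNReal.ofReal_mul (by positivity),
      ← ENNReal.ofReal_add (by positivity) (by positivity),
      ENNReal.ofReal_le_ofReal_iff (by positivity)] at key2
    have hρN : 0 < ρ ^ N * ϖ := by positivity
    rw [← le_div_iff₀' hρN] at key2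
    refine key2.trans (le_of_eq ?_)
    rw [hD]; field_simp
  · have hi := integrableOn_of_abs_le hAJ hwm
      (fun z => by rw [abs_of_nonneg (hH0 _)]; exact hHW z)
    rw [← ENNReal.ofReal_le_ofReal_iff (by positivity), ofReal_integral_eq_lintegral_ofReal hi
      (Eventually.of_forall fun z => hH0 _)]
    exact (lintegral_mono_set (prod_mono hsub le_rfl)).trans hZ
  · have i0 := integrableOn_of_abs_le hAJ (hpow (Λ + 1) (by linarith)) (hpowb _ (by linarith))
    have i1 := (integrableOn_of_abs_le hAJ (hpow (q + 1) (by linarith))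
      (hpowb _ (by linarith))).const_mul (l ^ (Λ - q))
    have i2 := (integrableOn_of_abs_le hAJ hwm
      (fun z => by rw [abs_of_nonneg (hH0 _)]; exact hHW z)).const_mul (l ^ Λ)
    rw [← integral_const_mul, ← integral_const_mul, ← integral_add i2 i1]
    exact integral_mono i0 (i2.add i1) fun z => rpow_le_interpolate hΛ hqΛ (hH0 _) hl

end DecayStep

/-! ### Decay on shrinking balls, De Giorgi iteration, and passage to all times. -/

section DecayAndIteration

variable {N : ℕ}

/-- Superlinear decay of `mass` on shrinking balls, for solutions vanishing initially. -/
theorem exists_decay {Ω : Set (E N)} {T : ℝ} {a : ℝ → ℝ} {Λ : ℝ} {u : E N × ℝ → ℝ}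
    (hΩ : IsOpen Ω) (hT : 0 < T) (ha : DiffusionCoeff a) (hΛ : 0 < Λ)
    (hle : ∀ s, 0 < s → Λ * (a s * I a s) ≤ 1) {c μ : ℝ} (hc : 0 < c) (hμ : 0 < μ)
    (hmono : ∀ u v : ℝ, 0 < u → u < v → c * (a v * I a v ^ μ) ≤ a u * I a u ^ μ)
    (hu : IsWeakSol Ω T a Λ u) {M : ℝ} (hM0 : 0 < M) {v : E N × ℝ → ℝ} (hv : Measurable v)
    (hv0 : ∀ z, 0 ≤ v z) (hvM : ∀ z, v z ≤ M)
    (hvu : ∀ᵐ z ∂(volume.restrict (cyl Ω T)), v z = u z) {x₀ : E N} {r : ℝ} (hr : 0 < r)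
    (hball : Metric.ball x₀ r ⊆ Ω)
    (h0 : ∀ᵐ x ∂(volume.restrict (Metric.ball x₀ r)), u (x, 0) = 0) :
    ∃ C₁ : ℝ, 0 < C₁ ∧ ∃ C₂ : ℝ, 0 < C₂ ∧ ∃ δ : ℝ, 0 < δ ∧ ∀ s R d B : ℝ, 0 < s → s ≤ T →
      0 < d → d ≤ R → R ≤ r → 0 < B → B ≤ 1 → C₁ / d ^ 2 * mass a Λ v x₀ s R < B →
      mass a Λ v x₀ s (R - d) ≤ C₂ * (d ^ N)⁻¹ * B ^ (1 + δ) := by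
  obtain ⟨q, hq1, hqΛ, k, hk, hK, hkb⟩ := exists_power_profile ha hΛ hle hc hμ hmono
  obtain ⟨Ck, hCk, hkM⟩ := hkb M hM0
  obtain ⟨g, hg, hweak⟩ := hu.weak
  have hW := H_pos ha hΛ hM0
  have hϖ := volume_unitBall_pos (N := N)
  have hH0 := H_nonneg ha hΛ
  have hHc := H_continuous ha hΛ hle
  have hHm := H_monotone ha hΛ
  have hQm : MeasurableSet (cyl Ω T) := hΩ.measurableSet.prod measurableSet_Ioo
  have huM : ∀ᵐ z ∂(volume.restrict (cyl Ω T)), u z ≤ M := by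
    filter_upwards [hvu] with z hz
    rw [← hz]; exact hvM z
  obtain ⟨C, hC, δ, hδ, harith⟩ := exists_superlinear_bound N hΛ hqΛ hr hT
    (A₁ := H a Λ M * (1 + Ck * T / 2))
    (A₂ := H a Λ M ^ (q - 1) * T / (volume (Metric.ball (0 : E N) 1)).toReal)
    (by positivity) (by have := Real.rpow_pos_of_pos hW (q - 1); positivity)
  -- The energy estimate has the constant `2L²/Λ`, and the cutoff has slope `L = 4/d`.
  refine ⟨32 / Λ, by positivity, C, hC, δ, hδ, fun s R d B hs hsT hd hdR hRr hB hB1 hsmall => ?_⟩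
  obtain ⟨ρ, hρ, hρd, l, hl, hfin⟩ := harith d B hd (hdR.trans hRr) hB hB1
  obtain ⟨ψ, hψ, hψL, hψP, hψ1⟩ := exists_cutoff x₀ R hd
  set P := Metric.closedBall x₀ (R - d / 4) with hPdef
  have hP : IsCompact P := isCompact_closedBall _ _
  have hPR : P ⊆ Metric.ball x₀ R := Metric.closedBall_subset_ball (by linarith)
  have hPr : P ⊆ Metric.ball x₀ r := hPR.trans (Metric.ball_subset_ball hRr)
  have hPΩ : P ⊆ Ω := hPr.trans hball
  set O := Metric.ball x₀ (R - d / 2) with hOdef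
  have hOP : O ⊆ P := Metric.ball_subset_closedBall.trans
    (Metric.closedBall_subset_closedBall (by linarith))
  set f : ℝ → ℝ := fun s => H a Λ (min s M) with hf
  have hfc : Continuous f := hHc.comp (continuous_id.min continuous_const)
  have hf0 : ∀ s, 0 ≤ f s := fun s => hH0 _
  have hfB : ∀ s, |f s| ≤ H a Λ M := fun s => by
    rw [abs_of_nonneg (hf0 _)]; exact hHm (min_le_right _ _)
  have hψsq : ∀ x, |ψ x ^ 2| ≤ 1 := fun x => by
    rw [abs_of_nonneg (sq_nonneg _)]
    nlinarith [(hψ x).1, (hψ x).2]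
  set m : ℝ → ℝ := fun t => ∫ x in P, ψ x ^ 2 * f (u (x, t)) with hm
  have hmc : ContinuousOn m (Icc 0 T) :=
    continuousOn_integral_slice hu hP hPΩ hfc hfB (hψL.continuous.pow 2) hψsq
  have hm0 : m 0 = 0 := by
    refine integral_eq_zero_of_ae ?_
    filter_upwards [ae_mono (Measure.restrict_mono hPr le_rfl) h0] with x hx
    simp only [hx, hf, Pi.zero_apply, H_of_nonpos (min_le_left (0 : ℝ) M), mul_zero]
  -- small initial times
  obtain ⟨τ, hτ, hmτ⟩ : ∃ τ > 0, ∀ t, 0 < t → t < τ → t ≤ T →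
      m t + 32 / Λ / d ^ 2 * mass a Λ v x₀ s R < B := by
    have hlim : Tendsto m (𝓝[Icc 0 T] 0) (𝓝 (m 0)) := hmc 0 ⟨le_rfl, hT.le⟩
    rw [hm0] at hlim
    -- The strict inequality in the smallness assumption leaves room for `m t` at small positive
    -- times. These serve as starting times, since the energy estimate does not reach `t = 0`.
    have hev := hlim.eventually_lt_const (sub_pos.2 hsmall)
    rw [eventually_nhdsWithin_iff, Metric.eventually_nhds_iff] at hev
    obtain ⟨τ, hτ, h⟩ := hev
    refine ⟨τ, hτ, fun t ht1 ht2 ht3 => ?_⟩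
    have := h (y := t) (by rwa [Real.dist_eq, sub_zero, abs_of_pos ht1]) ⟨ht1.le, ht3⟩
    linarith
  have hL : 2 * ((1 / (d / 4).toNNReal : NNReal) : ℝ) ^ 2 / Λ = 32 / Λ / d ^ 2 := by
    rw [NNReal.coe_div, Real.coe_toNNReal _ (by positivity)]
    push_cast; field_simp; norm_num
  have hYP : ∫ z in P ×ˢ Ioo 0 s, H a Λ (u z) ^ (Λ + 1) ≤ mass a Λ v x₀ s R := by
    have hsub : P ×ˢ Ioo 0 s ⊆ cyl Ω T := prod_mono hPΩ (Ioo_subset_Ioo le_rfl hsT)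
    have e : ∫ z in P ×ˢ Ioo 0 s, H a Λ (u z) ^ (Λ + 1) =
        ∫ z in P ×ˢ Ioo 0 s, H a Λ (v z) ^ (Λ + 1) := by
      refine integral_congr_ae ?_
      filter_upwards [ae_mono (Measure.restrict_mono hsub le_rfl) hvu] with z hz
      rw [hz]
    rw [e, mass]
    refine setIntegral_mono_set (integrableOn_of_abs_le (c := H a Λ M ^ (Λ + 1))
      (volume_cyl_ne_top _ _ _ _) ?_ fun z => ?_)
      (Eventually.of_forall fun z => Real.rpow_nonneg (hH0 _) _)
      (prod_mono hPR le_rfl).eventuallyLE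
    · exact (hHc.rpow_const fun _ => Or.inr (by positivity)).measurable.comp hv
    · rw [abs_of_nonneg (Real.rpow_nonneg (hH0 _) _)]
      exact Real.rpow_le_rpow (hH0 _) (hHm (hvM z)) (by positivity)
  have henergy : ∀ t₀ t₁, 0 < t₀ → t₀ < τ → t₀ < t₁ → t₁ < s →
      IntegrableOn (fun z => ψ z.1 ^ 2 * (deriv (F a Λ) (u z) * ‖g z‖ ^ 2)) (P ×ˢ Ioo t₀ t₁) ∧
      m t₁ + 1 / 2 * ∫ z in P ×ˢ Ioo t₀ t₁, ψ z.1 ^ 2 * (deriv (F a Λ) (u z) * ‖g z‖ ^ 2) ≤ B := by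
    intro t₀ t₁ h1 h2 h3 h4
    obtain ⟨hi, he⟩ := energy_inequality hΩ ha hΛ hle hu huM hg hweak hP hPΩ hψ hψL hψP h1 h3 h4
      hsT
    refine ⟨hi, he.trans ?_⟩
    rw [hL]
    refine le_trans ?_ (hmτ t₀ h1 h2 (by linarith)).le
    gcongr
  have hGnn : ∀ z, 0 ≤ ψ z.1 ^ 2 * (deriv (F a Λ) (u z) * ‖g z‖ ^ 2) := fun z =>
    mul_nonneg (sq_nonneg _) (mul_nonneg (deriv_F_nonneg ha hΛ hle _) (sq_nonneg _))
  have hmnn : ∀ t, 0 ≤ m t := fun t =>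
    integral_nonneg fun x => mul_nonneg (sq_nonneg _) (hf0 _)
  -- the estimate away from the initial time
  have claim : ∀ t₀ t₁, 0 < t₀ → t₀ < τ → t₀ < t₁ → t₁ < s →
      ∫ z in Metric.ball x₀ (R - d) ×ˢ Ioo t₀ t₁, H a Λ (v z) ^ (Λ + 1) ≤
        C * (d ^ N)⁻¹ * B ^ (1 + δ) := by
    intro t₀ t₁ ht₀ ht₀τ ht₀₁ ht₁
    have hDQ : P ×ˢ Icc t₀ t₁ ⊆ cyl Ω T :=
      prod_mono hPΩ fun t ht => ⟨by linarith [ht.1], by linarith [ht.2]⟩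
    have hOD : O ×ˢ Ioo t₀ t₁ ⊆ P ×ˢ Icc t₀ t₁ := prod_mono hOP Ioo_subset_Icc_self
    obtain ⟨G, hGm, hGi, hGg, hGw⟩ := exists_integrable_weak_gradient hQm hg hvu hv
      (M := M) (fun z => by rw [abs_of_nonneg (hv0 z)]; exact hvM z)
      (hP.prod isCompact_Icc) hDQ
    have hslice : ∀ᵐ t ∂(volume.restrict (Ioo t₀ t₁)),
        ∫⁻ x in O, ENNReal.ofReal (H a Λ (v (x, t))) ≤ ENNReal.ofReal B := by
      have h1 := ae_slice (ae_mono (Measure.restrict_mono (hOD.trans hDQ) le_rfl) hvu)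
      filter_upwards [h1, ae_restrict_mem measurableSet_Ioo] with t ht htm
      have htT : t ∈ Icc 0 T := ⟨by linarith [htm.1], by linarith [htm.2]⟩
      have hmi : Integrable (fun x => ψ x ^ 2 * f (u (x, t))) (volume.restrict P) := by
        refine Integrable.mono' (integrableOn_const (C := H a Λ M) hP.measure_ne_top) ?_
          (Eventually.of_forall fun x => ?_)
        · exact (hψL.continuous.pow 2).aestronglyMeasurable.mul
            (hfc.comp_aestronglyMeasurable ((hu.meas_slice _ htT).mono_measure
              (Measure.restrict_mono hPΩ le_rfl)))
        · rw [norm_mul]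
          exact (mul_le_of_le_one_left (norm_nonneg _) (hψsq x)).trans (hfB _)
      calc ∫⁻ x in O, ENNReal.ofReal (H a Λ (v (x, t)))
          = ∫⁻ x in O, ENNReal.ofReal (ψ x ^ 2 * f (u (x, t))) := by
            refine lintegral_congr_ae ?_
            filter_upwards [ht, ae_restrict_mem measurableSet_ball] with x hx hxO
            rw [hψ1 x hxO, ← hx, hf]
            simp only [min_eq_left (hvM (x, t)), one_pow, one_mul]
        _ ≤ ∫⁻ x in P, ENNReal.ofReal (ψ x ^ 2 * f (u (x, t))) := lintegral_mono_set hOP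
        _ = ENNReal.ofReal (m t) := (ofReal_integral_eq_lintegral_ofReal hmi
            (Eventually.of_forall fun x => mul_nonneg (sq_nonneg _) (hf0 _))).symm
        _ ≤ ENNReal.ofReal B := by
            refine ENNReal.ofReal_le_ofReal ?_
            have h2 := (henergy t₀ t ht₀ ht₀τ htm.1 (htm.2.trans ht₁)).2
            have h3 : 0 ≤ ∫ z in P ×ˢ Ioo t₀ t,
                ψ z.1 ^ 2 * (deriv (F a Λ) (u z) * ‖g z‖ ^ 2) := integral_nonneg hGnn
            linarith
    obtain ⟨hEi, hE⟩ := henergy t₀ t₁ ht₀ ht₀τ ht₀₁ ht₁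
    have hgrad : ∫⁻ z in O ×ˢ Ioo t₀ t₁,
        ENNReal.ofReal (deriv (F a Λ) (v z) * ‖G z‖ ^ 2) ≤ ENNReal.ofReal (2 * B) := by
      calc ∫⁻ z in O ×ˢ Ioo t₀ t₁, ENNReal.ofReal (deriv (F a Λ) (v z) * ‖G z‖ ^ 2)
          = ∫⁻ z in O ×ˢ Ioo t₀ t₁,
              ENNReal.ofReal (ψ z.1 ^ 2 * (deriv (F a Λ) (u z) * ‖g z‖ ^ 2)) := by
            refine lintegral_congr_ae ?_
            filter_upwards [ae_mono (Measure.restrict_mono (hOD.trans hDQ) le_rfl) hvu,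
              ae_mono (Measure.restrict_mono hOD le_rfl) hGg,
              ae_restrict_mem (measurableSet_ball.prod measurableSet_Ioo)] with z h1 h2 h3
            rw [hψ1 z.1 h3.1, h1, h2, one_pow, one_mul]
        _ ≤ ∫⁻ z in P ×ˢ Ioo t₀ t₁,
              ENNReal.ofReal (ψ z.1 ^ 2 * (deriv (F a Λ) (u z) * ‖g z‖ ^ 2)) :=
            lintegral_mono_set (prod_mono hOP le_rfl)
        _ = ENNReal.ofReal (∫ z in P ×ˢ Ioo t₀ t₁,
              ψ z.1 ^ 2 * (deriv (F a Λ) (u z) * ‖g z‖ ^ 2)) :=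
            (ofReal_integral_eq_lintegral_ofReal hEi (Eventually.of_forall hGnn)).symm
        _ ≤ ENNReal.ofReal (2 * B) := by
            refine ENNReal.ofReal_le_ofReal ?_
            linarith [hmnn t₁]
    obtain ⟨X, Z, hX, hZ, hy⟩ := interior_decay ha hΛ hle hM0 hv hv0 hvM hq1 hqΛ hk hK hCk hkM hρ
      (R' := R - d) (R := R - d / 2) (by linarith) ht₀₁ (T := T) (by linarith) hB hl hGm hGi
      (fun h ψ h1 h2 h3 => hGw h ψ h1 h2 (h3.trans hOD)) hslice hgrad
    exact hfin X Z _ hX hZ hy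
  -- exhaustion in time
  set S : ℕ → Set (E N × ℝ) := fun n =>
    Metric.ball x₀ (R - d) ×ˢ Ioo (s / (n + 3)) (s - s / (n + 3)) with hS
  have hanti : Antitone fun n : ℕ => s / ((n : ℝ) + 3) := fun n n' h => by
    have : (n : ℝ) ≤ n' := by exact_mod_cast h
    dsimp only; gcongr
  have hlim0 : Tendsto (fun n : ℕ => s / ((n : ℝ) + 3)) atTop (𝓝 0) :=
    tendsto_const_nhds.div_atTop (tendsto_atTop_add_const_right _ _ tendsto_natCast_atTop_atTop)
  have hSU : ⋃ n, S n = Metric.ball x₀ (R - d) ×ˢ Ioo 0 s := by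
    ext z
    simp only [hS, mem_iUnion, mem_prod, mem_Ioo]
    constructor
    · rintro ⟨n, h1, h2, h3⟩
      have : 0 < s / ((n : ℝ) + 3) := by positivity
      exact ⟨h1, by linarith, by linarith⟩
    · rintro ⟨h1, h2, h3⟩
      obtain ⟨n, hn⟩ := ((hlim0.eventually_lt_const h2).and
        (hlim0.eventually_lt_const (sub_pos.2 h3))).exists
      exact ⟨n, h1, hn.1, by linarith [hn.2]⟩
  have hint : IntegrableOn (fun z => H a Λ (v z) ^ (Λ + 1)) (⋃ n, S n) := by
    rw [hSU]
    refine integrableOn_of_abs_le (c := H a Λ M ^ (Λ + 1)) (volume_cyl_ne_top _ _ _ _) ?_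
      fun z => ?_
    · exact (hHc.rpow_const fun _ => Or.inr (by positivity)).measurable.comp hv
    · rw [abs_of_nonneg (Real.rpow_nonneg (hH0 _) _)]
      exact Real.rpow_le_rpow (hH0 _) (hHm (hvM z)) (by positivity)
  have htend := tendsto_setIntegral_of_monotone
    (fun n => measurableSet_ball.prod measurableSet_Ioo)
    (fun n n' h => prod_mono le_rfl (Ioo_subset_Ioo (hanti h) (by linarith [hanti h]))) hint
  rw [hSU] at htend
  refine le_of_tendsto htend ?_
  filter_upwards [hlim0.eventually_lt_const hτ] with n hn
  have hpos : 0 < s / ((n : ℝ) + 3) := by positivity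
  -- The shift by `3` guarantees that `s/(n+3) < s - s/(n+3)`.
  have h3 : s / ((n : ℝ) + 3) ≤ s / 3 := by
    gcongr; linarith [Nat.cast_nonneg (α := ℝ) n]
  exact claim _ _ hpos hn (by linarith) (by linarith)

/-- The De Giorgi iteration. -/
theorem exists_iteration_threshold (N : ℕ) {C₁ C₂ δ d₀ : ℝ} (hC₁ : 0 < C₁) (hC₂ : 0 < C₂)
    (hδ : 0 < δ) (hd₀ : 0 < d₀) :
    ∃ y₀ > 0, ∀ Y : ℕ → ℝ, Y 0 ≤ y₀ →
      (∀ n B, 0 < B → B ≤ 1 → C₁ / (d₀ / 2 ^ (n + 1)) ^ 2 * Y n < B →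
        Y (n + 1) ≤ C₂ * ((d₀ / 2 ^ (n + 1)) ^ N)⁻¹ * B ^ (1 + δ)) →
      ∃ b, 0 < b ∧ b < 1 ∧ ∀ n, Y n ≤ y₀ * b ^ n := by
  -- Halving `d` multiplies `d^(-N)` by `2^N` and `d^(-2)` by `4`. Thus `D` is the growth of the
  -- constants per step, and the ratio `b` is taken with `D b^δ ≤ 1` to beat it.
  set D : ℝ := 2 ^ N * 4 ^ (1 + δ) with hD
  have hD0 : 0 < D := by
    have := Real.rpow_pos_of_pos (show (0 : ℝ) < 4 by norm_num) (1 + δ)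
    positivity
  set b : ℝ := min (1 / 4) (D⁻¹ ^ (1 / δ)) with hb
  have hb0 : 0 < b := lt_min (by norm_num) (Real.rpow_pos_of_pos (by positivity) _)
  have hb4 : b ≤ 1 / 4 := min_le_left _ _
  have hbD : D * b ^ δ ≤ 1 := by
    have h1 : b ^ δ ≤ D⁻¹ := by
      calc b ^ δ ≤ (D⁻¹ ^ (1 / δ)) ^ δ := Real.rpow_le_rpow hb0.le (min_le_right _ _) hδ.le
        _ = D⁻¹ := by rw [← Real.rpow_mul (by positivity), one_div_mul_cancel hδ.ne', Real.rpow_one]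
    calc D * b ^ δ ≤ D * D⁻¹ := by gcongr
      _ = 1 := mul_inv_cancel₀ hD0.ne'
  -- Twice the constant `4 C₁/d₀²` of the first step, so that the required inequality for `B` is
  -- strict.
  set A : ℝ := 8 * C₁ / d₀ ^ 2 with hA
  have hA0 : 0 < A := by positivity
  set K : ℝ := C₂ * (d₀ ^ N)⁻¹ * 2 ^ N * A ^ (1 + δ) with hK
  have hK0 : 0 < K := by have := Real.rpow_pos_of_pos hA0 (1 + δ); positivity
  set y₀ : ℝ := min (1 / A) ((b / K) ^ (1 / δ)) with hy
  have hy0 : 0 < y₀ := lt_min (by positivity) (Real.rpow_pos_of_pos (by positivity) _)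
  have hyA : A * y₀ ≤ 1 := by
    calc A * y₀ ≤ A * (1 / A) := by gcongr; exact min_le_left _ _
      _ = 1 := mul_one_div_cancel hA0.ne'
  have hyK : K * y₀ ^ δ ≤ b := by
    have h1 : y₀ ^ δ ≤ b / K := by
      calc y₀ ^ δ ≤ ((b / K) ^ (1 / δ)) ^ δ := Real.rpow_le_rpow hy0.le (min_le_right _ _) hδ.le
        _ = b / K := by
          rw [← Real.rpow_mul (by positivity), one_div_mul_cancel hδ.ne', Real.rpow_one]
    rw [le_div_iff₀ hK0] at h1; linarith
  refine ⟨y₀, hy0, fun Y hY0 hstep => ⟨b, hb0, by linarith, fun n => ?_⟩⟩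
  induction n with
  | zero => simpa using hY0
  | succ n ih =>
    -- Twice the bound that the induction hypothesis gives for the left side of the smallness
    -- condition. The choices `b ≤ 1/4` and `A y₀ ≤ 1` ensure `B ≤ 1`.
    set B : ℝ := A * y₀ * (4 * b) ^ n with hB
    have hB0 : 0 < B := by positivity
    have hB1 : B ≤ 1 := mul_le_one₀ hyA (by positivity) (pow_le_one₀ (by positivity) (by linarith))
    have hlt : C₁ / (d₀ / 2 ^ (n + 1)) ^ 2 * Y n < B := by
      have e : C₁ / (d₀ / 2 ^ (n + 1)) ^ 2 * (y₀ * b ^ n) = B / 2 := by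
        rw [hB, hA, mul_pow, div_pow, ← pow_mul, show (2 : ℝ) ^ ((n + 1) * 2) = 4 * 4 ^ n by
          rw [mul_comm, pow_mul, pow_succ]; norm_num [mul_comm]]
        field_simp; norm_num
      calc C₁ / (d₀ / 2 ^ (n + 1)) ^ 2 * Y n ≤ C₁ / (d₀ / 2 ^ (n + 1)) ^ 2 * (y₀ * b ^ n) := by
            gcongr
        _ = B / 2 := e
        _ < B := by linarith
    refine (hstep n B hB0 hB1 hlt).trans ?_
    have e1 : ((d₀ / 2 ^ (n + 1)) ^ N)⁻¹ = (d₀ ^ N)⁻¹ * 2 ^ N * (2 ^ N) ^ n := by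
      rw [div_pow, inv_div, ← pow_mul, ← pow_mul, mul_comm (n + 1) N, mul_add, pow_add, mul_one]
      field_simp
    have e2 : B ^ (1 + δ) = A ^ (1 + δ) * (y₀ * y₀ ^ δ) * (4 ^ (1 + δ) * b ^ δ * b) ^ n := by
      rw [hB, Real.mul_rpow (by positivity) (by positivity), Real.mul_rpow hA0.le hy0.le,
        Real.rpow_one_add' hy0.le (by positivity), ← Real.rpow_pow_comm (by positivity),
        Real.mul_rpow (by norm_num) hb0.le, Real.rpow_one_add' hb0.le (by positivity)]
      congr 2; ring
    calc C₂ * ((d₀ / 2 ^ (n + 1)) ^ N)⁻¹ * B ^ (1 + δ)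
        = (K * y₀ ^ δ) * y₀ * ((D * b ^ δ) ^ n * b ^ n) := by
          rw [e1, e2, hK, hD]
          simp only [mul_pow]
          ring
      _ ≤ b * y₀ * (1 * b ^ n) := by
          gcongr
          exact pow_le_one₀ (by positivity) hbD
      _ = y₀ * b ^ (n + 1) := by ring

/-- Vanishing at almost all times implies vanishing at all times. -/
theorem IsWeakSol.slice_eq_zero {Ω : Set (E N)} {T s : ℝ} {a : ℝ → ℝ} {Λ : ℝ}
    {u : E N × ℝ → ℝ} (hu : IsWeakSol Ω T a Λ u) (hs : 0 < s) (hsT : s ≤ T) {K : Set (E N)}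
    (hK : IsCompact K) (hKΩ : K ⊆ Ω) {S : Set (E N)} (hSK : S ⊆ K)
    (h : ∀ᵐ t ∂(volume.restrict (Ioo 0 s)), ∀ᵐ x ∂(volume.restrict S), u (x, t) = 0) :
    ∀ t ∈ Icc 0 s, ∀ᵐ x ∂(volume.restrict S), u (x, t) = 0 := by
  intro t ht
  rw [ae_restrict_iff' measurableSet_Ioo] at h
  -- A set of full measure is dense, so every time in `[0,s]`, endpoints included, is a limit of
  -- good times in `(0,s)`.
  have hd := (Measure.dense_of_ae h).open_subset_closure_inter (isOpen_Ioo (a := 0) (b := s))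
  have ht' : t ∈ closure (Ioo 0 s ∩ {t | t ∈ Ioo 0 s →
      ∀ᵐ x ∂(volume.restrict S), u (x, t) = 0}) := by
    refine closure_minimal hd isClosed_closure ?_
    rwa [closure_Ioo hs.ne]
  obtain ⟨ts, hts, hlim⟩ := mem_closure_iff_seq_limit.1 ht'
  have hIcc : ∀ n, ts n ∈ Icc 0 T := fun n => ⟨(hts n).1.1.le, (hts n).1.2.le.trans hsT⟩
  have hlim' : Tendsto ts atTop (𝓝[Icc 0 T] t) :=
    tendsto_nhdsWithin_iff.2 ⟨hlim, Eventually.of_forall hIcc⟩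
  have hconv : TendstoInMeasure (volume.restrict K) (fun n x => u (x, ts n)) atTop
      (fun x => u (x, t)) := fun ε hε =>
    (hu.cont t ⟨ht.1, ht.2.trans hsT⟩ K hKΩ hK ε hε).comp hlim'
  obtain ⟨ms, -, hae⟩ := hconv.exists_seq_tendsto_ae
  have hz : ∀ᵐ x ∂(volume.restrict S), ∀ n, u (x, ts (ms n)) = 0 :=
    ae_all_iff.2 fun n => (hts (ms n)).2 (hts (ms n)).1
  filter_upwards [ae_mono (Measure.restrict_mono hSK le_rfl) hae, hz] with x hx hx0
  simp only [hx0] at hx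
  exact tendsto_nhds_unique hx tendsto_const_nhds |>.trans rfl

/-- For an unbounded set `sSup` is `0`, and `1 / 0 = 0` would contradict `0 < Λ`. The hypothesis on
`Λ` therefore forces `a I` to be bounded with a positive supremum. -/
theorem mul_aI_le_one {a : ℝ → ℝ} {Λ : ℝ} (hΛ_pos : 0 < Λ)
    (hΛ : Λ < 1 / max (sSup ((fun u => a u * I a u) '' Ioi 0)) 0) {s : ℝ} (hs : 0 < s) :
    Λ * (a s * I a s) ≤ 1 := by
  set S := (fun u => a u * I a u) '' Ioi 0 with hS
  have h1 : 0 < max (sSup S) 0 := one_div_pos.1 (hΛ_pos.trans hΛ)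
  have h2 : 0 < sSup S := by
    rcases lt_max_iff.1 h1 with h | h
    · exact h
    · exact absurd h (lt_irrefl _)
  have hbdd : BddAbove S := by
    by_contra hc
    rw [Real.sSup_of_not_bddAbove hc] at h2
    exact lt_irrefl _ h2
  have h3 : a s * I a s ≤ sSup S := le_csSup hbdd ⟨s, hs, rfl⟩
  rw [max_eq_left h2.le, lt_div_iff₀ h2] at hΛ
  exact (mul_le_mul_of_nonneg_left h3 hΛ_pos.le).trans hΛ.le

end DecayAndIteration

end FPS

end

/-! ### Finite propagation speed. -/

theorem theorem5p1 {N : ℕ} (hN : 1 ≤ N)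
    (a : ℝ → ℝ) (ha : FPS.DiffusionCoeff a)
    (ha_zero : limsup (fun u => ((a u * FPS.I a u : ℝ) : EReal)) (𝓝[>] (0 : ℝ)) < ⊤)
    (ha_mono : ∃ c > (0 : ℝ), ∃ μ > (0 : ℝ), ∀ u v : ℝ, 0 < u → u < v →
      c * (a v * FPS.I a v ^ μ) ≤ a u * FPS.I a u ^ μ)
    (Λ : ℝ) (hΛ_pos : 0 < Λ)
    (hΛ : Λ < 1 / max (sSup ((fun u => a u * FPS.I a u) '' Ioi 0)) 0)
    (Ω : Set (FPS.E N)) (hΩ_open : IsOpen Ω) (hΩ_conn : IsConnected Ω)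
    (T : ℝ) (hT : 0 < T)
    (u : FPS.E N × ℝ → ℝ) (hu : FPS.IsWeakSol Ω T a Λ u) :
    FPS.FinitePropagationSpeed Ω T u := by
  obtain ⟨c, hc, μ, hμ, hmono⟩ := ha_mono
  have hle : ∀ s, 0 < s → Λ * (a s * FPS.I a s) ≤ 1 := fun s hs =>
    FPS.mul_aI_le_one hΛ_pos hΛ hs
  have hH0 := FPS.H_nonneg ha hΛ_pos
  have hHm := FPS.H_monotone ha hΛ_pos
  have hHc := FPS.H_continuous ha hΛ_pos hle
  have hΛ1 : 0 < Λ + 1 := by linarith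
  intro x₀ r hr hball ε hε
  -- The time may depend on `u`, so when the initial value does not vanish on the ball `s = T` works
  -- vacuously.
  by_cases h0 : ∀ᵐ x ∂(volume.restrict (Metric.ball x₀ r)), u (x, 0) = 0
  swap
  · exact ⟨T, ⟨hT, le_rfl⟩, fun h => absurd h h0⟩
  -- a bounded Borel version of the solution
  obtain ⟨M, hM0, hM⟩ : ∃ M : ℝ, 0 < M ∧ ∀ᵐ z ∂(volume.restrict (FPS.cyl Ω T)), u z ≤ M := by
    obtain ⟨hum, hub⟩ := hu.bounded
    rw [eLpNorm_exponent_top] at hub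
    refine ⟨(eLpNormEssSup u (volume.restrict (FPS.cyl Ω T))).toReal + 1, by positivity, ?_⟩
    filter_upwards [enorm_ae_le_eLpNormEssSup u (volume.restrict (FPS.cyl Ω T))] with z hz
    have h1 : ‖u z‖ ≤ (eLpNormEssSup u (volume.restrict (FPS.cyl Ω T))).toReal := by
      rw [← toReal_enorm]
      exact ENNReal.toReal_mono hub.ne hz
    linarith [Real.le_norm_self (u z)]
  set v : FPS.E N × ℝ → ℝ := fun z => max 0 (min (hu.bounded.1.mk u z) M) with hvdef
  have hv : Measurable v :=
    measurable_const.max (hu.bounded.1.stronglyMeasurable_mk.measurable.min measurable_const)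
  have hv0 : ∀ z, 0 ≤ v z := fun z => le_max_left _ _
  have hvM : ∀ z, v z ≤ M := fun z => max_le hM0.le (min_le_right _ _)
  have hvu : ∀ᵐ z ∂(volume.restrict (FPS.cyl Ω T)), v z = u z := by
    filter_upwards [hu.bounded.1.ae_eq_mk, hM, hu.nonneg] with z h1 h2 h3
    rw [hvdef]
    dsimp only
    rw [← h1, min_eq_left h2, max_eq_right h3]
  obtain ⟨C₁, hC₁, C₂, hC₂, δ, hδ, hdecay⟩ := FPS.exists_decay hΩ_open hT ha hΛ_pos hle hc hμ hmono
    hu hM0 hv hv0 hvM hvu hr hball h0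
  obtain ⟨hε0, hε1⟩ := hε
  set d₀ := (1 - ε) * r with hd₀
  have hd₀pos : 0 < d₀ := mul_pos (by linarith) hr
  obtain ⟨y₀, hy₀, hiter⟩ := FPS.exists_iteration_threshold N hC₁ hC₂ hδ hd₀pos
  -- choice of the time
  set V := volume.real (Metric.ball x₀ r) with hV
  set W := FPS.H a Λ M ^ (Λ + 1) with hW
  have hW0 : 0 ≤ W := Real.rpow_nonneg (hH0 _) _
  have hV0 : 0 ≤ V := measureReal_nonneg
  have hden : 0 < W * V + 1 := by positivity
  -- On the full ball the starting integral is at most `s W V`, which this choice puts below `y₀`.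
  -- The `+ 1` keeps the denominator positive.
  set s := min T (y₀ / (W * V + 1)) with hs
  have hs0 : 0 < s := lt_min hT (by positivity)
  have hsT : s ≤ T := min_le_left _ _
  have hHpow : ∀ z, FPS.H a Λ (v z) ^ (Λ + 1) ≤ W := fun z =>
    Real.rpow_le_rpow (hH0 _) (hHm (hvM z)) hΛ1.le
  have hHpow0 : ∀ z, 0 ≤ FPS.H a Λ (v z) ^ (Λ + 1) := fun z => Real.rpow_nonneg (hH0 _) _
  have hHmeas : Measurable fun z => FPS.H a Λ (v z) ^ (Λ + 1) :=
    (hHc.rpow_const fun _ => Or.inr hΛ1.le).measurable.comp hv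
  have hInt : ∀ R, IntegrableOn (fun z => FPS.H a Λ (v z) ^ (Λ + 1))
      (Metric.ball x₀ R ×ˢ Ioo 0 s) := fun R =>
    FPS.integrableOn_of_abs_le (FPS.volume_cyl_ne_top _ _ _ _) hHmeas (c := W)
      fun z => by rw [abs_of_nonneg (hHpow0 z)]; exact hHpow z
  -- The radii `ε r + d₀/2^n` decrease from `r` to `ε r`, with consecutive gaps `d₀/2^(n+1)`.
  have hR : ∀ n : ℕ, ε * r + d₀ / 2 ^ n - d₀ / 2 ^ (n + 1) = ε * r + d₀ / 2 ^ (n + 1) := by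
    intro n; rw [pow_succ]; field_simp; ring
  have hd_le : ∀ n : ℕ, d₀ / 2 ^ n ≤ d₀ := fun n =>
    div_le_self hd₀pos.le (one_le_pow₀ (by norm_num))
  have hεr : 0 < ε * r := mul_pos hε0 hr
  have hstart : FPS.mass a Λ v x₀ s r ≤ y₀ := by
    rw [FPS.mass]
    have h1 : ∫ z in Metric.ball x₀ r ×ˢ Ioo 0 s, FPS.H a Λ (v z) ^ (Λ + 1) ≤
        ∫ _ in Metric.ball x₀ r ×ˢ Ioo 0 s, W :=
      setIntegral_mono (hInt r) (integrableOn_const (FPS.volume_cyl_ne_top _ _ _ _)) hHpow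
    refine h1.trans ?_
    rw [setIntegral_const, Measure.volume_eq_prod, measureReal_prod_prod, ← hV,
      Real.volume_real_Ioo, sub_zero, max_eq_left hs0.le, smul_eq_mul]
    have h2 : s * (W * V + 1) ≤ y₀ := by
      rw [← le_div_iff₀ hden]; exact min_le_right _ _
    nlinarith
  have hr_eq : ε * r + d₀ / 2 ^ 0 = r := by rw [pow_zero, div_one, hd₀]; ring
  obtain ⟨b, hb0, hb1, hb⟩ := hiter (fun n => FPS.mass a Λ v x₀ s (ε * r + d₀ / 2 ^ n))
    (by rwa [hr_eq]) (fun n B hB hB1 hlt => by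
      rw [← hR n]
      have h2 : d₀ / 2 ^ (n + 1) ≤ d₀ / 2 ^ n := by
        rw [pow_succ, ← div_div]
        exact half_le_self (by positivity)
      have h3 : ε * r + d₀ = r := by rw [hd₀]; ring
      exact hdecay s _ _ B hs0 hsT (by positivity) (by linarith) (by linarith [hd_le n]) hB hB1 hlt)
  -- conclusion
  have hzero : ∫ z in Metric.ball x₀ (ε * r) ×ˢ Ioo 0 s, FPS.H a Λ (v z) ^ (Λ + 1) = 0 := by
    refine le_antisymm ?_ (integral_nonneg hHpow0)
    have hlim : Tendsto (fun n : ℕ => y₀ * b ^ n) atTop (𝓝 0) := by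
      simpa using (tendsto_pow_atTop_nhds_zero_of_lt_one hb0.le hb1).const_mul y₀
    refine ge_of_tendsto' hlim fun n => ?_
    refine le_trans ?_ (hb n)
    refine setIntegral_mono_set (hInt _) (Eventually.of_forall hHpow0)
      (Set.prod_mono (Metric.ball_subset_ball ?_) le_rfl).eventuallyLE
    have : 0 < d₀ / 2 ^ n := by positivity
    linarith
  have hεr_lt : ε * r < r := mul_lt_of_lt_one_left hr hε1
  have hsub : Metric.ball x₀ (ε * r) ×ˢ Ioo 0 s ⊆ FPS.cyl Ω T :=
    Set.prod_mono ((Metric.ball_subset_ball hεr_lt.le).trans hball) (Ioo_subset_Ioo le_rfl hsT)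
  have hae : ∀ᵐ z ∂(volume.restrict (Metric.ball x₀ (ε * r) ×ˢ Ioo 0 s)), u z = 0 := by
    have h1 := (integral_eq_zero_iff_of_nonneg hHpow0 (hInt _)).1 hzero
    filter_upwards [h1, ae_mono (Measure.restrict_mono hsub le_rfl) hvu] with z hz hzu
    rw [← hzu]
    by_contra hne
    have hpos : 0 < v z := lt_of_le_of_ne (hv0 z) (Ne.symm hne)
    exact (Real.rpow_pos_of_pos (FPS.H_pos ha hΛ_pos hpos) (Λ + 1)).ne' hz
  refine ⟨s, ⟨hs0, hsT⟩, fun _ => ?_⟩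
  exact hu.slice_eq_zero hs0 hsT (isCompact_closedBall x₀ (ε * r))
    ((Metric.closedBall_subset_ball hεr_lt).trans hball) Metric.ball_subset_closedBall
    (FPS.ae_slice hae)
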